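/- Let $k$ and $n$ be integers such that either $k\ge 3$ is odd and $n\ge 2k+4$, or $k=2$ and $n\ge 9$. Then there exists a neighborly $(2k+1)$-polytope $P\subset\mathbb{R}^{2k+1}$ with exactly $n$ vertices all of whose missing faces have dimension $k$ (that is, have exactly $k+1$ elements); in particular, $m_{k+1}(P)=0$. Here a $d$-polytope is the convex hull of a finite set of points whose affine span has dimension $d$; it is simplicial if all of its proper faces are simplices. The boundary complex $\partial P$ of a simplicial polytope $P$ is the collection of vertex sets of proper faces of $P$ (including $\emptyset$). A $d$-polytope is neighborly if it is simplicial and every set of $\lfloor d/2\rfloor$ of its vertices belongs to $\partial P$, equivalently $f_{\lfloor d/2\rfloor-1}=\binom{f_0}{\lfloor d/2\rfloor}$, where $f_{j-1}$ is the number of $j$-element sets in $\partial P$. A missing face of $P$ is a set $M$ of vertices of $P$ such that $M\notin\partial P$ but every proper subset of $M$ belongs to $\partial P$; its dimension is $|M|-1$, and $m_i(P)$ is the number of missing faces of dimension $i$. -/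

import Mathlib

namespace ConvexPolytope

/-- A polytope: the convex hull of a finite set of points. -/
def IsPolytope {E : Type*} [NormedAddCommGroup E] [NormedSpace ℝ E] (P : Set E) : Prop :=
  ∃ S : Finset E, P = convexHull ℝ (S : Set E)

/-- The dimension of `P`: the dimension of its affine span. -/
noncomputable def dim {E : Type*} [NormedAddCommGroup E] [NormedSpace ℝ E] (P : Set E) : ℕ :=
  Module.finrank ℝ (vectorSpan ℝ P)

/-- The vertices of `P`. -/
def vertices {E : Type*} [NormedAddCommGroup E] [NormedSpace ℝ E] (P : Set E) : Set E :=
  P.extremePoints ℝ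

/-- A proper face of `P`: the intersection of `P` with a supporting hyperplane (equivalently, the
set of maximizers on `P` of a linear functional), other than `P` itself. As usual, the empty set
is counted as a (proper) face. -/
def IsProperFace {E : Type*} [NormedAddCommGroup E] [NormedSpace ℝ E] (P F : Set E) : Prop :=
  IsExposed ℝ P F ∧ F ≠ P

/-- A simplex: the convex hull of finitely many affinely independent points. -/
def IsSimplex {E : Type*} [NormedAddCommGroup E] [NormedSpace ℝ E] (F : Set E) : Prop :=
  ∃ S : Finset E, AffineIndependent ℝ ((↑) : S → E) ∧ F = convexHull ℝ (S : Set E)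

/-- `P` is simplicial: all of its proper faces are simplices. -/
def IsSimplicial {E : Type*} [NormedAddCommGroup E] [NormedSpace ℝ E] (P : Set E) : Prop :=
  ∀ F : Set E, IsProperFace P F → IsSimplex F

/-- The boundary complex of `P`: the collection of the vertex sets of the proper faces of `P`
(the empty set included). -/
def boundaryComplex {E : Type*} [NormedAddCommGroup E] [NormedSpace ℝ E] (P : Set E) :
    Set (Finset E) :=
  {s | ∃ F : Set E, IsProperFace P F ∧ (s : Set E) = vertices F}

/-- The number of faces with exactly `j` elements in the boundary complex of `P`; in terms of the
`f`-vector, this is `f_{j-1}(P)`. -/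
noncomputable def faceCount {E : Type*} [NormedAddCommGroup E] [NormedSpace ℝ E] (P : Set E)
    (j : ℕ) : ℕ :=
  {s : Finset E | s ∈ boundaryComplex P ∧ s.card = j}.ncard

/-- `P` is `i`-neighborly: `f_{i-1} = (f_0 choose i)`. -/
def IsNeighborlyOfOrder {E : Type*} [NormedAddCommGroup E] [NormedSpace ℝ E] (i : ℕ)
    (P : Set E) : Prop :=
  faceCount P i = (faceCount P 1).choose i

/-- `P` is neighborly: a simplicial polytope that is `⌊d/2⌋`-neighborly, where `d = dim P`. -/
def IsNeighborly {E : Type*} [NormedAddCommGroup E] [NormedSpace ℝ E] (P : Set E) : Prop :=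
  IsPolytope P ∧ IsSimplicial P ∧ IsNeighborlyOfOrder (dim P / 2) P

/-- `M` is a missing face of `P`: a set of vertices of `P` that is not a face of the boundary
complex although all of its proper subsets are. -/
def IsMissingFace {E : Type*} [NormedAddCommGroup E] [NormedSpace ℝ E] (P : Set E)
    (M : Finset E) : Prop :=
  (M : Set E) ⊆ vertices P ∧ M ∉ boundaryComplex P ∧ ∀ s : Finset E, s ⊂ M → s ∈ boundaryComplex P

/-- The number `m_i(P)` of missing `i`-faces of `P`, that is, missing faces with `i + 1`
elements. -/
noncomputable def missingFaceCount {E : Type*} [NormedAddCommGroup E] [NormedSpace ℝ E]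
    (P : Set E) (i : ℕ) : ℕ :=
  {M : Finset E | IsMissingFace P M ∧ M.card = i + 1}.ncard

end ConvexPolytope

/-!
New vertices are added one at a time, by sewing. A new vector is placed near `v a₁`, beyond `v b₁`,
and is perturbed to the lexicographic position given by a flag of edges `{a₁, b₁}, {a₂, b₂}, …`. Its
link and its deletion are then determined along the flag. If the flag has `k` edges and the
complexes along it are neighborly with small missing faces, then the new complex is again
`k`-neighborly with missing faces of at most `k + 1` elements, and the same flag can be used again.
By neighborliness every missing face has more than `k` elements, hence exactly `k + 1`.

It remains to find configurations to start with, as Gale duals. For `k = 2 * t + 1` these are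
`4 * t + 6` vectors in the plane, in `2 * t + 3` groups of two, with signs alternating from group to
group: by Gale duality, a set is a nonface exactly if the vectors outside it lie in an open
half-plane, so that the missing faces are unions of `t + 1` groups. For `k = 2` there is an explicit
configuration of nine vectors in three-space.
-/

namespace ConvexPolytope

section SewingFlags

variable {ι : Type*} {P K L A B : Set (Finset ι)} {F S : Finset ι} {a b : ι}
  {flag : List (ι × ι)} {m : ℕ}

/-- Every missing face of the complex `L` that is a face of the complex `K` has at most `m`
elements. For `K = Set.univ` this bounds all missing faces of `L`. -/
def MissingFacesLE (K L : Set (Finset ι)) (m : ℕ) : Prop :=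
  ∀ ⦃G⦄, G ∈ K → G ∉ L → ∃ M ⊆ G, M.card ≤ m ∧ M ∉ L

theorem MissingFacesLE.mono_left (h : MissingFacesLE K L m) (hP : P ⊆ K) :
    MissingFacesLE P L m :=
  fun _ hG hG' => h (hP hG) hG'

variable [DecidableEq ι]

/-- The link of `F` in the complex `K`, with the vertices of `F` kept as cone points, so that
iterated links are complexes on the same vertex type. -/
def link (K : Set (Finset ι)) (F : Finset ι) : Set (Finset ι) :=
  {S | F ∪ S ∈ K}

/-- A flag of edges `{a₁, b₁}, {a₂, b₂}, …` along which a new vertex can be sewn to the complex `K`: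
with `m` edges of the flag left, all sets of at most `m` elements are faces of the current complex,
and passing to the link of `a₁` or of `{a₁, b₁}` creates only missing faces of at most `m`
elements. -/
def IsSewingFlag : Set (Finset ι) → List (ι × ι) → Prop
  | K, [] => ∅ ∈ K
  | K, (a, b) :: flag =>
    (∀ G : Finset ι, G.card ≤ flag.length + 1 → G ∈ K) ∧
    MissingFacesLE K (link K {a}) (flag.length + 1) ∧
    MissingFacesLE K (link K {a, b}) (flag.length + 1) ∧
    IsSewingFlag (link K {a, b}) flag

/-- How one edge `{a, b}` of a sewing flag governs the complex obtained from `K` by sewing in a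
new vertex: `A` is the deletion of the new vertex and `B` its link. -/
structure LexStep (K A B : Set (Finset ι)) (a b : ι) : Prop where
  mem_deletion : ∀ ⦃S⦄, a ∉ S → S ∈ K → S ∈ A
  mem_link_of_insert_mem : ∀ ⦃S⦄, a ∉ S → b ∉ S → insert a S ∈ K → S ∈ B
  insert_mem_of_mem_link : ∀ ⦃S⦄, S ∈ B → insert a S ∈ K
  insert_right_mem_link : ∀ ⦃S⦄, a ∉ S → insert a (insert b S) ∈ K →
    insert a (insert b S) ∉ A → insert b S ∈ B
  insert_both_mem_link : ∀ ⦃S⦄, insert b S ∈ B → insert a (insert b S) ∈ A →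
    insert a (insert b S) ∈ B
  insert_left_mem_link : ∀ ⦃S⦄, b ∉ S → insert a (insert b S) ∈ A → insert a S ∈ B
  insert_both_mem_deletion : ∀ ⦃S⦄, insert a S ∈ A → insert a (insert b S) ∈ A

/-- The new vertex with deletion `A` and link `B` is sewn to `K` along the whole flag: each edge
governs the links of the preceding edges. -/
def LexChain : Set (Finset ι) → Set (Finset ι) → Set (Finset ι) → List (ι × ι) → Prop
  | K, A, B, [] => K ⊆ A ∧ B = ∅
  | K, A, B, (a, b) :: flag =>
    LexStep K A B a b ∧ LexChain (link K {a, b}) (link A {a, b}) (link B {a, b}) flag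

theorem mem_link : S ∈ link K F ↔ F ∪ S ∈ K :=
  Iff.rfl

theorem mem_link_singleton : S ∈ link K {a} ↔ insert a S ∈ K := by
  rw [mem_link, ← Finset.insert_eq]

theorem mem_link_pair : S ∈ link K {a, b} ↔ insert a (insert b S) ∈ K := by
  rw [mem_link, Finset.insert_union, ← Finset.insert_eq]

theorem link_empty (K : Set (Finset ι)) : link K ∅ = K := by
  ext S
  rw [mem_link, Finset.empty_union]

theorem link_link_comm (K : Set (Finset ι)) (F F' : Finset ι) :
    link (link K F) F' = link (link K F') F := by
  ext S
  simp only [mem_link, Finset.union_left_comm]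

theorem link_mono (h : A ⊆ K) (F : Finset ι) : link A F ⊆ link K F :=
  fun _ hS => h hS

theorem isLowerSet_link (hK : IsLowerSet K) (F : Finset ι) : IsLowerSet (link K F) :=
  fun _ _ hTS hS => hK (Finset.union_subset_union_right hTS) hS

theorem LexStep.link_of_notMem (h : LexStep K A B a b) (ha : a ∉ F) (hb : b ∉ F) :
    LexStep (link K F) (link A F) (link B F) a b := by
  constructor <;> intro S <;> simp only [mem_link, Finset.union_insert]
  · exact fun haS => h.mem_deletion (by simp [ha, haS])
  · exact fun haS hbS => h.mem_link_of_insert_mem (by simp [ha, haS]) (by simp [hb, hbS])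
  · exact fun hS => h.insert_mem_of_mem_link hS
  · exact fun haS => h.insert_right_mem_link (by simp [ha, haS])
  · exact fun hS => h.insert_both_mem_link hS
  · exact fun hbS => h.insert_left_mem_link (by simp [hb, hbS])
  · exact fun hS => h.insert_both_mem_deletion hS

theorem LexChain.link_of_notMem (h : LexChain K A B flag) (hF : ∀ p ∈ flag, p.1 ∉ F ∧ p.2 ∉ F) :
    LexChain (link K F) (link A F) (link B F) flag := by
  induction flag generalizing K A B with
  | nil => exact ⟨link_mono h.1 F, by rw [h.2]; rfl⟩
  | cons p flag ih =>
    obtain ⟨hp, hflag⟩ := List.forall_mem_cons.1 hF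
    refine ⟨h.1.link_of_notMem hp.1 hp.2, ?_⟩
    rw [link_link_comm K, link_link_comm A, link_link_comm B]
    exact ih h.2 hflag

theorem LexStep.insert_left_mem_link_of_mem (h : LexStep K A B a b) (hS : S ∈ B)
    (haS : insert a S ∈ A) : insert a S ∈ B := by
  by_cases ha : a ∈ S
  · rwa [Finset.insert_eq_of_mem ha]
  by_cases hb : b ∈ S
  · rw [← Finset.insert_eq_of_mem hb] at hS haS ⊢
    exact h.insert_both_mem_link hS haS
  · exact h.insert_left_mem_link hb (h.insert_both_mem_deletion haS)

theorem LexStep.missingFacesLE_link_singleton (h : LexStep K A B a b) (hA : IsLowerSet A)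
    (hab : MissingFacesLE A (link A {a, b}) m) :
    MissingFacesLE A (link A {a}) m := by
  intro G hG haG
  obtain ⟨M, hMG, hM, hMA⟩ := hab hG fun habG =>
    haG (mem_link_singleton.2 (hA (by grind) (mem_link_pair.1 habG)))
  exact ⟨M, hMG, hM, fun haM =>
    hMA (mem_link_pair.2 (h.insert_both_mem_deletion (mem_link_singleton.1 haM)))⟩

theorem IsSewingFlag.mem_of_card_le (h : IsSewingFlag K flag) {G : Finset ι}
    (hG : G.card ≤ flag.length) : G ∈ K := by
  cases flag with
  | nil => rwa [Finset.card_eq_zero.1 (Nat.le_zero.1 hG)]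
  | cons p flag => exact h.1 G hG

theorem LexChain.mem_of_card_le (h : LexChain K A B flag) (hK : IsSewingFlag K flag)
    (hA : IsLowerSet A) (hB : IsLowerSet B) (G : Finset ι) :
    (G.card ≤ flag.length → G ∈ A) ∧ (G.card + 1 ≤ flag.length → G ∈ B) := by
  induction flag generalizing K A B G with
  | nil => exact ⟨fun hG => h.1 (hK.mem_of_card_le hG), fun hG => by simp at hG⟩
  | cons p flag ih =>
    obtain ⟨a, b⟩ := p
    have ih (G : Finset ι) := ih h.2 hK.2.2.2 (isLowerSet_link hA _) (isLowerSet_link hB _) G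
    simp only [mem_link_pair] at ih
    rw [List.length_cons]
    refine ⟨fun hG => ?_, fun hG => ?_⟩
    · by_cases ha : a ∈ G
      · have hcard := Finset.card_erase_add_one ha
        exact hA (by grind) ((ih (G.erase a)).1 (by omega))
      · exact h.1.mem_deletion ha (hK.1 G hG)
    · by_cases hab : a ∈ G ∨ b ∈ G
      · obtain ⟨c, hc, hcG⟩ : ∃ c ∈ ({a, b} : Finset ι), c ∈ G := by simpa using hab
        have hcard := Finset.card_erase_add_one hcG
        exact hB (by grind) ((ih (G.erase c)).2 (by omega))
      · rw [not_or] at hab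
        refine h.1.mem_link_of_insert_mem hab.1 hab.2 (hK.1 _ ?_)
        have := Finset.card_insert_le a G
        omega

theorem LexChain.missingFacesLE_deletion (h : LexChain K A B flag) (hK : IsSewingFlag K flag)
    (hlow : IsLowerSet K) (hA : IsLowerSet A) (hAK : A ⊆ K)
    (hP : MissingFacesLE P K (flag.length + 1)) : MissingFacesLE P A (flag.length + 1) := by
  induction flag generalizing P K A B with
  | nil =>
    intro G hG hGA
    obtain ⟨M, hMG, hM, hMK⟩ := hP hG fun hGK => hGA (h.1 hGK)
    exact ⟨M, hMG, hM, fun hMA => hMK (hAK hMA)⟩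
  | cons p flag ih =>
    obtain ⟨a, b⟩ := p
    intro G hG hGA
    by_cases hGK : G ∈ K
    · have ha : a ∈ G := by_contra fun ha => hGA (h.1.mem_deletion ha hGK)
      have herase : G.erase a ∈ A :=
        h.1.mem_deletion (Finset.notMem_erase a G) (hlow (Finset.erase_subset a G) hGK)
      obtain ⟨M, hMG, hM, hMA⟩ := ih h.2 hK.2.2.2 (isLowerSet_link hlow _) (isLowerSet_link hA _)
        (link_mono hAK _) (hK.2.2.1.mono_left hAK) herase
        (fun hlink => hGA (hA (by grind) (mem_link_pair.1 hlink)))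
      refine ⟨insert a M, by grind, ?_, fun haM => hMA ?_⟩
      · have := Finset.card_insert_le a M
        rw [List.length_cons]
        omega
      · exact mem_link_pair.2 (h.1.insert_both_mem_deletion haM)
    · obtain ⟨M, hMG, hM, hMK⟩ := hP hG hGK
      exact ⟨M, hMG, hM, fun hMA => hMK (hAK hMA)⟩

theorem LexChain.missingFacesLE_link (h : LexChain K A B flag) (hK : IsSewingFlag K flag)
    (hA : IsLowerSet A) (hB : IsLowerSet B) (hAK : A ⊆ K) :
    MissingFacesLE A B flag.length := by
  induction flag generalizing K A B with
  | nil => exact fun G _ _ => ⟨∅, Finset.empty_subset G, le_rfl, by simp [h.2]⟩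
  | cons p flag ih =>
    obtain ⟨a, b⟩ := p
    intro G hGA hGB
    have of_right_mem (hb : b ∈ G) (hG : insert a (insert b G) ∈ A) :
        ∃ M ⊆ G, M.card ≤ flag.length + 1 ∧ M ∉ B := by
      obtain ⟨M, hMG, hM, hMB⟩ := ih h.2 hK.2.2.2 (isLowerSet_link hA _) (isLowerSet_link hB _)
        (link_mono hAK _) (mem_link_pair.2 hG)
        (fun hlink => hGB (hB (by grind) (mem_link_pair.1 hlink)))
      refine ⟨insert b M, by grind, ?_, fun hbM => hMB (mem_link_pair.2 ?_)⟩
      · have := Finset.card_insert_le b M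
        omega
      · exact h.1.insert_both_mem_link hbM (hA (by grind) hG)
    rw [List.length_cons]
    by_cases ha : a ∈ G
    · have hbA : insert a (insert b G) ∈ A :=
        h.1.insert_both_mem_deletion (by rwa [Finset.insert_eq_of_mem ha])
      refine of_right_mem (by_contra fun hb => hGB ?_) hbA
      rw [← Finset.insert_erase ha]
      exact h.1.insert_left_mem_link (by grind) (hA (by grind) hbA)
    by_cases haK : insert a G ∈ K
    · have hb : b ∈ G := by_contra fun hb => hGB (h.1.mem_link_of_insert_mem ha hb haK)
      refine of_right_mem hb (by_contra fun hnA => hGB ?_)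
      rw [← Finset.insert_erase hb, Finset.insert_idem] at hnA
      rw [← Finset.insert_erase hb] at haK ⊢
      exact h.1.insert_right_mem_link (by grind) haK hnA
    · obtain ⟨M, hMG, hM, hMK⟩ :=
        hK.2.1 (hAK hGA) fun hlink => haK (mem_link_singleton.1 hlink)
      exact ⟨M, hMG, hM, fun hMB =>
        hMK (mem_link_singleton.2 (h.1.insert_mem_of_mem_link hMB))⟩

end SewingFlags

section NewVertex

variable {ι : Type*} {K L : Set (Finset (Option ι))} {K₀ : Set (Finset ι)}
  {flag : List (ι × ι)} {m : ℕ}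

/-- The deletion of the vertex `none` from a complex on `Option ι`. -/
def deleteNone (K : Set (Finset (Option ι))) : Set (Finset ι) :=
  {S | S.map .some ∈ K}

/-- The link of the vertex `none` in a complex on `Option ι`. -/
def linkNone (K : Set (Finset (Option ι))) : Set (Finset ι) :=
  {S | S.insertNone ∈ K}

theorem mem_deleteNone {S : Finset ι} : S ∈ deleteNone K ↔ S.map .some ∈ K :=
  Iff.rfl

theorem mem_linkNone {S : Finset ι} : S ∈ linkNone K ↔ S.insertNone ∈ K :=
  Iff.rfl

theorem isLowerSet_deleteNone (hK : IsLowerSet K) : IsLowerSet (deleteNone K) :=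
  fun _ _ hTS hS => hK (Finset.map_subset_map.2 hTS) hS

theorem isLowerSet_linkNone (hK : IsLowerSet K) : IsLowerSet (linkNone K) :=
  fun _ _ hTS hS => hK (Finset.insertNone.monotone hTS) hS

theorem exists_eq_map_some_or_eq_insertNone (G : Finset (Option ι)) :
    ∃ S : Finset ι, G = S.map .some ∨ G = S.insertNone := by
  classical
  refine ⟨G.eraseNone, ?_⟩
  by_cases h : none ∈ G
  · exact Or.inr (by rw [Finset.insertNone_eraseNone, Finset.insert_eq_of_mem h])
  · exact Or.inl (by rw [Finset.map_some_eraseNone, Finset.erase_eq_of_notMem h])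

theorem missingFacesLE_of_deleteNone_of_linkNone (hK : IsLowerSet K)
    (hdel : MissingFacesLE (deleteNone K) (deleteNone L) (m + 1))
    (hlink : MissingFacesLE (linkNone K ∩ deleteNone L) (linkNone L) m) :
    MissingFacesLE K L (m + 1) := by
  have of_mem_deleteNone {S : Finset ι} (hS : S ∈ deleteNone K) (hSL : S ∉ deleteNone L) :
      ∃ M ⊆ S.map .some, M.card ≤ m + 1 ∧ M ∉ L := by
    obtain ⟨M, hMS, hM, hML⟩ := hdel hS hSL
    exact ⟨M.map .some, Finset.map_subset_map.2 hMS, by rwa [Finset.card_map], hML⟩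
  have map_some_subset (S : Finset ι) : S.map .some ⊆ S.insertNone := by
    intro x
    simp only [Finset.mem_map, Finset.mem_insertNone]
    rintro ⟨y, hy, rfl⟩ z hz
    rwa [Option.some.inj hz] at hy
  intro G hGK hGL
  obtain ⟨S, rfl | rfl⟩ := exists_eq_map_some_or_eq_insertNone G
  · exact of_mem_deleteNone hGK hGL
  by_cases hSL : S ∈ deleteNone L
  · obtain ⟨M, hMS, hM, hML⟩ := hlink ⟨hGK, hSL⟩ hGL
    exact ⟨M.insertNone, Finset.insertNone.monotone hMS, by rw [Finset.card_insertNone]; omega, hML⟩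
  · obtain ⟨M, hMS, hM⟩ := of_mem_deleteNone (hK (map_some_subset S) hGK) hSL
    exact ⟨M, hMS.trans (map_some_subset S), hM⟩

variable [DecidableEq ι]

theorem deleteNone_link_map (K : Set (Finset (Option ι))) (F : Finset ι) :
    deleteNone (link K (F.map .some)) = link (deleteNone K) F := by
  ext S
  simp only [mem_deleteNone, mem_link, Finset.map_union]

theorem linkNone_link_map (K : Set (Finset (Option ι))) (F : Finset ι) :
    linkNone (link K (F.map .some)) = link (linkNone K) F := by
  ext S
  rw [mem_linkNone, mem_link, mem_link, mem_linkNone]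
  congr! 1
  ext (_ | x) <;> simp

theorem LexStep.missingFacesLE_link_singleton_some
    (h : LexStep K₀ (deleteNone K) (linkNone K) a b) (hK : IsLowerSet K)
    (hdel : MissingFacesLE (deleteNone K) (link (deleteNone K) {a, b}) (m + 1)) :
    MissingFacesLE K (link K {some a}) (m + 1) := by
  rw [← Function.Embedding.some_apply, ← Finset.map_singleton]
  refine missingFacesLE_of_deleteNone_of_linkNone hK ?_ ?_
  · rw [deleteNone_link_map]
    exact h.missingFacesLE_link_singleton (isLowerSet_deleteNone hK) hdel
  · rw [deleteNone_link_map, linkNone_link_map]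
    rintro G ⟨hG, haG⟩ hG'
    rw [mem_link_singleton] at haG hG'
    exact absurd (h.insert_left_mem_link_of_mem hG haG) hG'

theorem LexChain.isSewingFlag (h : LexChain K₀ (deleteNone K) (linkNone K) flag)
    (hflag : IsSewingFlag K₀ flag) (hK₀ : IsLowerSet K₀) (hK : IsLowerSet K)
    (hsub : deleteNone K ⊆ K₀) :
    IsSewingFlag K (flag.map (Prod.map some some)) := by
  induction flag generalizing K₀ K with
  | nil =>
    have hempty : ∅ ∈ deleteNone K := h.1 (hflag.mem_of_card_le (Nat.le_refl 0))
    exact hempty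
  | cons p flag ih =>
    obtain ⟨a, b⟩ := p
    have hA := isLowerSet_deleteNone hK
    have hB := isLowerSet_linkNone hK
    have hdel : MissingFacesLE (deleteNone K) (link (deleteNone K) {a, b}) (flag.length + 1) :=
      h.2.missingFacesLE_deletion hflag.2.2.2 (isLowerSet_link hK₀ _) (isLowerSet_link hA _)
        (link_mono hsub _) (hflag.2.2.1.mono_left hsub)
    have hlink := h.2.missingFacesLE_link hflag.2.2.2 (isLowerSet_link hA _)
      (isLowerSet_link hB _) (link_mono hsub _)
    have hpair : ({some a, some b} : Finset (Option ι)) = ({a, b} : Finset ι).map .some := by simp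
    rw [List.map_cons, Prod.map_apply]
    refine ⟨fun G hG => ?_, ?_, ?_, ?_⟩
    · rw [List.length_map] at hG
      obtain ⟨S, rfl | rfl⟩ := exists_eq_map_some_or_eq_insertNone G
      · exact (h.mem_of_card_le hflag hA hB S).1 (by simpa using hG)
      · exact (h.mem_of_card_le hflag hA hB S).2 (by simpa using hG)
    · rw [List.length_map]
      exact h.1.missingFacesLE_link_singleton_some hK hdel
    · rw [List.length_map, hpair]
      refine missingFacesLE_of_deleteNone_of_linkNone hK ?_ ?_
      · rwa [deleteNone_link_map]
      · rw [deleteNone_link_map, linkNone_link_map]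
        exact hlink.mono_left Set.inter_subset_right
    · rw [hpair]
      refine ih ?_ hflag.2.2.2 (isLowerSet_link hK₀ _) (isLowerSet_link hK _) ?_
      · rw [deleteNone_link_map, linkNone_link_map]
        exact h.2
      · rw [deleteNone_link_map]
        exact link_mono hsub _

theorem LexChain.missingFacesLE (h : LexChain K₀ (deleteNone K) (linkNone K) flag)
    (hflag : IsSewingFlag K₀ flag) (hK₀ : IsLowerSet K₀) (hK : IsLowerSet K)
    (hsub : deleteNone K ⊆ K₀) (hmissing : MissingFacesLE Set.univ K₀ (flag.length + 1)) :
    MissingFacesLE Set.univ K (flag.length + 1) := by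
  have hA := isLowerSet_deleteNone hK
  refine missingFacesLE_of_deleteNone_of_linkNone isLowerSet_univ ?_ ?_
  · exact h.missingFacesLE_deletion hflag hK₀ hA hsub hmissing
  · exact (h.missingFacesLE_link hflag hA (isLowerSet_linkNone hK) hsub).mono_left
      Set.inter_subset_right

end NewVertex

open Filter Topology

section FaceComplex

variable {ι W : Type*} [AddCommGroup W] [Module ℝ W] {v : ι → Module.Dual ℝ W}
  {y : Module.Dual ℝ W} {S T : Finset ι} {h h₁ h₂ : W} {d : ℕ}

/-- The normal cone of the face `S` of the configuration `v`: the functionals on the space of `v`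
that are nonnegative on `v` and vanish on `S`. The vectors `v i` are themselves encoded as
functionals on the space `W` of these functionals. -/
def normalCone (v : ι → Module.Dual ℝ W) (S : Finset ι) : Set W :=
  {h | (∀ i, 0 ≤ v i h) ∧ ∀ i ∈ S, v i h = 0}

/-- The complex of the proper faces of the cone spanned by the configuration `v`. -/
def faceComplex (v : ι → Module.Dual ℝ W) : Set (Finset ι) :=
  {S | ∃ h ∈ normalCone v S, h ≠ 0}

/-- General position of a configuration of more than `d` vectors that spans a space of dimension
`d + 1`: any `d + 1` of its vectors span. -/
structure GeneralPosition [Fintype ι] (v : ι → Module.Dual ℝ W) (d : ℕ) : Prop where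
  finrank_eq : Module.finrank ℝ W = d + 1
  lt_card : d < Fintype.card ι
  eq_zero : ∀ ⦃h : W⦄ ⦃S : Finset ι⦄, (∀ i ∈ S, v i h = 0) → d < S.card → h = 0

/-- The configuration `v` with an additional vector `y`, indexed by `none`. -/
def extend (v : ι → Module.Dual ℝ W) (y : Module.Dual ℝ W) : Option ι → Module.Dual ℝ W :=
  fun o => o.elim y v

theorem normalCone_anti (hST : S ⊆ T) : normalCone v T ⊆ normalCone v S :=
  fun _ hh => ⟨hh.1, fun i hi => hh.2 i (hST hi)⟩

theorem smul_mem_normalCone {c : ℝ} (hc : 0 ≤ c) (hh : h ∈ normalCone v S) :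
    c • h ∈ normalCone v S :=
  ⟨fun i => by simpa using mul_nonneg hc (hh.1 i), fun i hi => by simp [hh.2 i hi]⟩

theorem add_mem_normalCone (hh₁ : h₁ ∈ normalCone v S) (hh₂ : h₂ ∈ normalCone v S) :
    h₁ + h₂ ∈ normalCone v S :=
  ⟨fun i => by simpa using add_nonneg (hh₁.1 i) (hh₂.1 i),
    fun i hi => by simp [hh₁.2 i hi, hh₂.2 i hi]⟩

theorem mem_normalCone_insert [DecidableEq ι] {a : ι} :
    h ∈ normalCone v (insert a S) ↔ h ∈ normalCone v S ∧ v a h = 0 := by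
  simp only [normalCone, Set.mem_ofPred_eq, Finset.forall_mem_insert]
  tauto

theorem isLowerSet_faceComplex (v : ι → Module.Dual ℝ W) : IsLowerSet (faceComplex v) :=
  fun _ _ hTS ⟨h, hh, h0⟩ => ⟨h, normalCone_anti hTS hh, h0⟩

theorem mem_deleteNone_faceComplex_extend :
    S ∈ deleteNone (faceComplex (extend v y)) ↔ ∃ h ∈ normalCone v S, h ≠ 0 ∧ 0 ≤ y h := by
  simp only [mem_deleteNone, faceComplex, normalCone, Set.mem_ofPred_eq, Option.forall,
    Finset.mem_map, Function.Embedding.some_apply, reduceCtorEq, Option.some.injEq, and_false,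
    exists_false, exists_eq_right, extend, Option.elim]
  exact exists_congr fun h => by tauto

theorem mem_linkNone_faceComplex_extend :
    S ∈ linkNone (faceComplex (extend v y)) ↔ ∃ h ∈ normalCone v S, h ≠ 0 ∧ y h = 0 := by
  simp only [mem_linkNone, faceComplex, normalCone, Set.mem_ofPred_eq, Option.forall,
    Finset.none_mem_insertNone, Finset.some_mem_insertNone, extend, Option.elim]
  refine exists_congr fun h => ⟨by tauto, fun ⟨hh, h0, hy⟩ => ?_⟩
  exact ⟨⟨⟨hy.ge, hh.1⟩, fun _ => hy, hh.2⟩, h0⟩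

theorem deleteNone_faceComplex_extend_subset :
    deleteNone (faceComplex (extend v y)) ⊆ faceComplex v := by
  intro S hS
  obtain ⟨h, hh, h0, -⟩ := mem_deleteNone_faceComplex_extend.1 hS
  exact ⟨h, hh, h0⟩

theorem neg_of_notMem_deleteNone (hA : S ∉ deleteNone (faceComplex (extend v y)))
    (hh : h ∈ normalCone v S) (h0 : h ≠ 0) : y h < 0 :=
  not_le.1 fun hy => hA (mem_deleteNone_faceComplex_extend.2 ⟨h, hh, h0, hy⟩)

end FaceComplex

section GeneralPosition

variable {ι W : Type*} [AddCommGroup W] [Module ℝ W] [Fintype ι] {v : ι → Module.Dual ℝ W}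
  {y : Module.Dual ℝ W} {S : Finset ι} {h h₁ h₂ : W} {d : ℕ}

theorem GeneralPosition.exists_eval_eq (hv : GeneralPosition v d) (hS : S.card ≤ d + 1)
    (f : ι → ℝ) : ∃ g : W, ∀ i ∈ S, v i g = f i := by
  have : FiniteDimensional ℝ W := Module.finite_of_finrank_pos (by rw [hv.finrank_eq]; omega)
  obtain ⟨T, hST, hT⟩ := Finset.exists_superset_card_eq hS hv.lt_card
  let e : W →ₗ[ℝ] (T → ℝ) := LinearMap.pi fun i => v i
  have he : Function.Injective e := by
    refine LinearMap.ker_eq_bot.1 (LinearMap.ker_eq_bot'.2 fun h hh => ?_)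
    exact hv.eq_zero (fun i hi => congrFun hh ⟨i, hi⟩) (by omega)
  obtain ⟨g, hg⟩ := (LinearMap.injective_iff_surjective_of_finrank_eq_finrank
    (by simp [hv.finrank_eq, hT])).1 he fun i => f i
  exact ⟨g, fun i hi => congrFun hg ⟨i, hST hi⟩⟩

theorem GeneralPosition.card_le (hv : GeneralPosition v d) (h0 : h ≠ 0)
    (hS : ∀ i ∈ S, v i h = 0) : S.card ≤ d :=
  not_lt.1 fun hd => h0 (hv.eq_zero hS hd)

theorem GeneralPosition.exists_pos (hv : GeneralPosition v d) (h0 : h ≠ 0)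
    (hh : ∀ i, 0 ≤ v i h) : ∃ i, 0 < v i h := by
  by_contra! hc
  refine h0 (hv.eq_zero (S := Finset.univ) (fun i _ => (hc i).antisymm (hh i)) ?_)
  simpa using hv.lt_card

theorem GeneralPosition.add_ne_zero (hv : GeneralPosition v d) (hh₁ : h₁ ∈ normalCone v S)
    (h0 : h₁ ≠ 0) (hh₂ : h₂ ∈ normalCone v S) : h₁ + h₂ ≠ 0 := by
  obtain ⟨i, hi⟩ := hv.exists_pos h0 hh₁.1
  intro hsum
  have : v i h₁ + v i h₂ = 0 := by rw [← map_add, hsum, map_zero]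
  linarith [hh₂.1 i]

theorem eventually_pos_add_mul {c : ℝ} (hc : 0 < c) (e : ℝ) :
    ∀ᶠ t in 𝓝[>] (0 : ℝ), 0 < c + t * e := by
  have hcont : Continuous fun t : ℝ => c + t * e := by fun_prop
  exact (hcont.tendsto 0).eventually (lt_mem_nhds (by simpa using hc)) |>.filter_mono
    nhdsWithin_le_nhds

/-- Perturb a witness by a functional that is positive at its superfluous zeros. -/
theorem GeneralPosition.exists_strict (hv : GeneralPosition v d) (hS : S ∈ faceComplex v) :
    ∃ h ∈ normalCone v S, h ≠ 0 ∧ ∀ i ∉ S, 0 < v i h := by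
  classical
  obtain ⟨h, hh, h0⟩ := hS
  let Z : Finset ι := {i | v i h = 0}
  have hZ : Z.card ≤ d := hv.card_le h0 fun i hi => (Finset.mem_filter.1 hi).2
  obtain ⟨g, hg⟩ := hv.exists_eval_eq (S := Z) (by omega) fun i => if i ∈ S then 0 else 1
  have hvanish (t : ℝ) : ∀ i ∈ S, v i (h + t • g) = 0 := fun i hi => by
    simp [hh.2 i hi, hg i (by simp [Z, hh.2 i hi]), hi]
  have hpos : ∀ i, ∀ᶠ t in 𝓝[>] (0 : ℝ), i ∉ S → 0 < v i (h + t • g) := by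
    intro i
    rcases (hh.1 i).lt_or_eq with hi | hi
    · filter_upwards [eventually_pos_add_mul hi (v i g)] with t ht _ using by simpa using ht
    · filter_upwards [self_mem_nhdsWithin] with t ht hiS
      simpa [hg i (by simp [Z, hi.symm]), ← hi, hiS] using ht
  obtain ⟨t, ht⟩ := (eventually_all.2 hpos).exists
  refine ⟨h + t • g, ⟨fun i => ?_, hvanish t⟩, fun hzero => ?_, ht⟩
  · by_cases hi : i ∈ S
    · exact (hvanish t i hi).ge
    · exact (ht i hi).le
  · obtain ⟨i, hi⟩ : ∃ i, i ∉ S := by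
      by_contra! hall
      have := hv.card_le h0 (S := Finset.univ) fun i _ => hh.2 i (hall i)
      have := hv.lt_card
      rw [Finset.card_univ] at *
      omega
    simpa [hzero] using ht i hi

theorem GeneralPosition.mem_linkNone_of_nonpos_of_nonneg (hv : GeneralPosition v d)
    (hh₁ : h₁ ∈ normalCone v S) (h₁0 : h₁ ≠ 0) (hy₁ : y h₁ ≤ 0)
    (hh₂ : h₂ ∈ normalCone v S) (h₂0 : h₂ ≠ 0) (hy₂ : 0 ≤ y h₂) :
    S ∈ linkNone (faceComplex (extend v y)) := by
  rw [mem_linkNone_faceComplex_extend]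
  rcases hy₁.eq_or_lt with hy₁ | hy₁
  · exact ⟨h₁, hh₁, h₁0, hy₁⟩
  have hh₂' := smul_mem_normalCone (neg_nonneg.2 hy₁.le) hh₂
  have hh₁' := smul_mem_normalCone hy₂ hh₁
  refine ⟨-y h₁ • h₂ + y h₂ • h₁, add_mem_normalCone hh₂' hh₁', ?_, by simp; ring⟩
  exact hv.add_ne_zero hh₂' (smul_ne_zero (neg_ne_zero.2 hy₁.ne) h₂0) hh₁'

theorem GeneralPosition.pos_of_notMem_linkNone (hv : GeneralPosition v d)
    (hA : S ∈ deleteNone (faceComplex (extend v y)))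
    (hB : S ∉ linkNone (faceComplex (extend v y))) :
    ∀ h ∈ normalCone v S, h ≠ 0 → 0 < y h := by
  obtain ⟨g, hg, g0, hyg⟩ := mem_deleteNone_faceComplex_extend.1 hA
  exact fun h hh h0 =>
    not_le.1 fun hy => hB (hv.mem_linkNone_of_nonpos_of_nonneg hh h0 hy hg g0 hyg)

end GeneralPosition

section LexVec

variable {ι W : Type*} [AddCommGroup W] [Module ℝ W] {v : ι → Module.Dual ℝ W}
  {y l : Module.Dual ℝ W} {a b : ι} {S : Finset ι} {h : W} {d : ℕ} {s : ℝ}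

/-- For small `s > 0`, a vector near `v a` that lies beyond `v b` as seen from `v a`, and whose
position relative to the faces through `a` and `b` is that of `l`: the new vertex of a sewing. -/
def lexVec (v : ι → Module.Dual ℝ W) (a b : ι) (l : Module.Dual ℝ W) (s : ℝ) : Module.Dual ℝ W :=
  v a - s • v b + s ^ 2 • l

theorem lexVec_apply : lexVec v a b l s h = v a h - s * v b h + s ^ 2 * l h := by
  simp [lexVec]

theorem eventually_lexVec_pos (ha : 0 < v a h) :
    ∀ᶠ s in 𝓝[>] (0 : ℝ), 0 < lexVec v a b l s h := by
  have hcont : Continuous fun s : ℝ => v a h - s * v b h + s ^ 2 * l h := by fun_prop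
  simp only [lexVec_apply]
  exact (hcont.tendsto 0).eventually (lt_mem_nhds (by simpa using ha)) |>.filter_mono
    nhdsWithin_le_nhds

theorem eventually_lexVec_neg (ha : v a h = 0) (hb : 0 < v b h) :
    ∀ᶠ s in 𝓝[>] (0 : ℝ), lexVec v a b l s h < 0 := by
  filter_upwards [eventually_pos_add_mul hb (-l h), self_mem_nhdsWithin] with s hs (hs0 : 0 < s)
  rw [lexVec_apply, ha]
  nlinarith

theorem mem_deleteNone_extend_lexVec (hs : 0 < s) (ha : a ∈ S) (hb : b ∈ S) :
    S ∈ deleteNone (faceComplex (extend v (lexVec v a b l s))) ↔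
      S ∈ deleteNone (faceComplex (extend v l)) := by
  simp only [mem_deleteNone_faceComplex_extend, lexVec_apply]
  refine exists_congr fun h => and_congr_right fun hh => ?_
  rw [hh.2 a ha, hh.2 b hb, mul_zero, sub_zero, zero_add,
    mul_nonneg_iff_of_pos_left (by positivity)]

theorem mem_linkNone_extend_lexVec (hs : 0 < s) (ha : a ∈ S) (hb : b ∈ S) :
    S ∈ linkNone (faceComplex (extend v (lexVec v a b l s))) ↔
      S ∈ linkNone (faceComplex (extend v l)) := by
  simp only [mem_linkNone_faceComplex_extend, lexVec_apply]
  refine exists_congr fun h => and_congr_right fun hh => ?_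
  rw [hh.2 a ha, hh.2 b hb, mul_zero, sub_zero, zero_add,
    mul_eq_zero_iff_left (pow_ne_zero 2 hs.ne')]

variable [Fintype ι]

theorem GeneralPosition.eventually_mem_deleteNone_lexVec (hv : GeneralPosition v d)
    (ha : a ∉ S) (hS : S ∈ faceComplex v) :
    ∀ᶠ s in 𝓝[>] (0 : ℝ), S ∈ deleteNone (faceComplex (extend v (lexVec v a b l s))) := by
  obtain ⟨h, hh, h0, hpos⟩ := hv.exists_strict hS
  filter_upwards [eventually_lexVec_pos (b := b) (l := l) (hpos a ha)] with s hs
  exact mem_deleteNone_faceComplex_extend.2 ⟨h, hh, h0, hs.le⟩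

variable [DecidableEq ι]

theorem GeneralPosition.eventually_mem_linkNone_lexVec (hv : GeneralPosition v d) (hab : a ≠ b)
    (ha : a ∉ S) (hb : b ∉ S) (hS : insert a S ∈ faceComplex v) :
    ∀ᶠ s in 𝓝[>] (0 : ℝ), S ∈ linkNone (faceComplex (extend v (lexVec v a b l s))) := by
  obtain ⟨h₁, hh₁, h₁0, hpos₁⟩ := hv.exists_strict hS
  obtain ⟨h₂, hh₂, h₂0, hpos₂⟩ :=
    hv.exists_strict (isLowerSet_faceComplex v (Finset.subset_insert a S) hS)
  filter_upwards [
    eventually_lexVec_neg (l := l) (hh₁.2 a (by simp)) (hpos₁ b (by simp [hab.symm, hb])),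
    eventually_lexVec_pos (b := b) (l := l) (hpos₂ a ha)] with s hs₁ hs₂
  exact hv.mem_linkNone_of_nonpos_of_nonneg (normalCone_anti (Finset.subset_insert a S) hh₁) h₁0
    hs₁.le hh₂ h₂0 hs₂.le

theorem GeneralPosition.eventually_insert_right_mem_linkNone_lexVec (hv : GeneralPosition v d)
    (hab : a ≠ b) (ha : a ∉ S) (hS : insert a (insert b S) ∈ faceComplex v) :
    ∀ᶠ s in 𝓝[>] (0 : ℝ),
      insert a (insert b S) ∉ deleteNone (faceComplex (extend v (lexVec v a b l s))) →
      insert b S ∈ linkNone (faceComplex (extend v (lexVec v a b l s))) := by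
  have hsub := Finset.subset_insert a (insert b S)
  obtain ⟨h₂, hh₂, h₂0, hpos₂⟩ := hv.exists_strict (isLowerSet_faceComplex v hsub hS)
  obtain ⟨h₁, hh₁, h₁0⟩ := hS
  filter_upwards [eventually_lexVec_pos (b := b) (l := l) (hpos₂ a (by simp [hab, ha]))]
    with s hs₂ hA
  exact hv.mem_linkNone_of_nonpos_of_nonneg (normalCone_anti hsub hh₁) h₁0
    (neg_of_notMem_deleteNone hA hh₁ h₁0).le hh₂ h₂0 hs₂.le

theorem GeneralPosition.eventually_insert_left_mem_linkNone_lexVec (hv : GeneralPosition v d)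
    (hab : a ≠ b) (hb : b ∉ S) :
    ∀ᶠ s in 𝓝[>] (0 : ℝ),
      insert a (insert b S) ∈ deleteNone (faceComplex (extend v (lexVec v a b l s))) →
      insert a S ∈ linkNone (faceComplex (extend v (lexVec v a b l s))) := by
  have hsub : insert a S ⊆ insert a (insert b S) :=
    Finset.insert_subset_insert a (Finset.subset_insert b S)
  by_cases hK : insert a S ∈ faceComplex v
  · obtain ⟨h₁, hh₁, h₁0, hpos₁⟩ := hv.exists_strict hK
    filter_upwards [
      eventually_lexVec_neg (l := l) (hh₁.2 a (by simp)) (hpos₁ b (by simp [hab.symm, hb]))]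
      with s hs₁ hA
    obtain ⟨h₂, hh₂, h₂0, hs₂⟩ := mem_deleteNone_faceComplex_extend.1 hA
    exact hv.mem_linkNone_of_nonpos_of_nonneg hh₁ h₁0 hs₁.le (normalCone_anti hsub hh₂) h₂0 hs₂
  · refine Eventually.of_forall fun s hA => absurd ?_ hK
    exact isLowerSet_faceComplex v hsub (deleteNone_faceComplex_extend_subset hA)

end LexVec

section Compactness

variable {W : Type*} [NormedAddCommGroup W] [NormedSpace ℝ W] [FiniteDimensional ℝ W] {C : Set W}

theorem eventually_pos_of_isClosed_cone (hC : IsClosed C)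
    (hsmul : ∀ c : ℝ, 0 ≤ c → ∀ h ∈ C, c • h ∈ C) {f : ℝ → Module.Dual ℝ W}
    (hf : Continuous fun p : ℝ × W => f p.1 p.2) {s₀ : ℝ} (hpos : ∀ h ∈ C, h ≠ 0 → 0 < f s₀ h) :
    ∀ᶠ s in 𝓝 s₀, ∀ h ∈ C, h ≠ 0 → 0 < f s h := by
  have hcompact : IsCompact (Metric.sphere (0 : W) 1 ∩ C) := (isCompact_sphere 0 1).inter_right hC
  have hsphere : ∀ᶠ s in 𝓝 s₀, ∀ h ∈ Metric.sphere (0 : W) 1 ∩ C, 0 < f s h := by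
    refine hcompact.eventually_forall_of_forall_eventually fun h hh => ?_
    exact hf.tendsto (s₀, h) |>.eventually
      (lt_mem_nhds (hpos h hh.2 (ne_zero_of_mem_unit_sphere ⟨h, hh.1⟩)))
  filter_upwards [hsphere] with s hs h hh h0
  have hnorm := norm_pos_iff.2 h0
  have hunit := hs (‖h‖⁻¹ • h)
    ⟨by simp [norm_smul, hnorm.ne'], hsmul _ (by positivity) h hh⟩
  rw [map_smul, smul_eq_mul] at hunit
  exact pos_of_mul_pos_right hunit (by positivity)

theorem eventually_pos_add_smul_of_isClosed_cone (hC : IsClosed C)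
    (hsmul : ∀ c : ℝ, 0 ≤ c → ∀ h ∈ C, c • h ∈ C) {f g : Module.Dual ℝ W}
    (hf : ∀ h ∈ C, 0 ≤ f h) (hg : ∀ h ∈ C, f h = 0 → h ≠ 0 → 0 < g h) :
    ∀ᶠ s in 𝓝[>] (0 : ℝ), ∀ h ∈ C, h ≠ 0 → 0 < f h + s * g h := by
  have hfc := f.continuous_of_finiteDimensional
  have hgc := g.continuous_of_finiteDimensional
  have hnonpos := eventually_pos_of_isClosed_cone (C := C ∩ {h | g h ≤ 0})
    (f := fun s => f + s • g) (s₀ := 0) (hC.inter (isClosed_le hgc continuous_const))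
    (fun c hc h hh => ⟨hsmul c hc h hh.1, by
      simpa using mul_nonpos_of_nonneg_of_nonpos hc hh.2⟩)
    (by simp only [LinearMap.add_apply, LinearMap.smul_apply]; fun_prop)
    (fun h hh h0 => by
      simpa using (hf h hh.1).lt_of_ne' fun hfh => (hg h hh.1 hfh h0).not_ge hh.2)
  filter_upwards [nhdsWithin_le_nhds hnonpos, self_mem_nhdsWithin] with s hs (hs0 : 0 < s) h hh h0
  rcases le_or_gt (g h) 0 with hgh | hgh
  · simpa using hs h ⟨hh, hgh⟩ h0
  · have := hf h hh
    positivity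

end Compactness

section LexStep

variable {ι W : Type*} [NormedAddCommGroup W] [NormedSpace ℝ W] [FiniteDimensional ℝ W]
  {v : ι → Module.Dual ℝ W} {l : Module.Dual ℝ W} {a b : ι} {S : Finset ι} {d : ℕ}

theorem isClosed_normalCone (v : ι → Module.Dual ℝ W) (S : Finset ι) :
    IsClosed (normalCone v S) := by
  have hv (i : ι) : Continuous (v i) := (v i).continuous_of_finiteDimensional
  simp only [normalCone, Set.ofPred_and, Set.ofPred_forall]
  exact (isClosed_iInter fun i => isClosed_le continuous_const (hv i)).inter
    (isClosed_biInter fun i _ => isClosed_eq (hv i) continuous_const)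

theorem eventually_lexVec_pos_on_normalCone (ha : ∀ h ∈ normalCone v S, h ≠ 0 → 0 < v a h) :
    ∀ᶠ s in 𝓝[>] (0 : ℝ), ∀ h ∈ normalCone v S, h ≠ 0 → 0 < lexVec v a b l s h := by
  have hac := (v a).continuous_of_finiteDimensional
  have hbc := (v b).continuous_of_finiteDimensional
  have hlc := l.continuous_of_finiteDimensional
  refine (eventually_pos_of_isClosed_cone (isClosed_normalCone v S)
    (fun c hc h hh => smul_mem_normalCone hc hh) (f := lexVec v a b l) (s₀ := 0) ?_ ?_).filter_mono
    nhdsWithin_le_nhds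
  · simp only [lexVec_apply]
    fun_prop
  · simpa [lexVec_apply] using ha

variable [DecidableEq ι]

theorem eventually_insert_mem_of_mem_linkNone_lexVec (v : ι → Module.Dual ℝ W)
    (l : Module.Dual ℝ W) (a b : ι) (S : Finset ι) :
    ∀ᶠ s in 𝓝[>] (0 : ℝ), S ∈ linkNone (faceComplex (extend v (lexVec v a b l s))) →
      insert a S ∈ faceComplex v := by
  by_cases haS : insert a S ∈ faceComplex v
  · simp [haS]
  have ha : ∀ h ∈ normalCone v S, h ≠ 0 → 0 < v a h := fun h hh h0 =>
    (hh.1 a).lt_of_ne' fun hah => haS ⟨h, mem_normalCone_insert.2 ⟨hh, hah⟩, h0⟩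
  filter_upwards [eventually_lexVec_pos_on_normalCone (b := b) (l := l) ha] with s hs hS
  obtain ⟨h, hh, h0, hzero⟩ := mem_linkNone_faceComplex_extend.1 hS
  exact absurd hzero (hs h hh h0).ne'

theorem eventually_insert_both_mem_deletion_lexVec (v : ι → Module.Dual ℝ W)
    (l : Module.Dual ℝ W) (a b : ι) (S : Finset ι) :
    ∀ᶠ s in 𝓝[>] (0 : ℝ), insert a S ∈ deleteNone (faceComplex (extend v (lexVec v a b l s))) →
      insert a (insert b S) ∈ deleteNone (faceComplex (extend v (lexVec v a b l s))) := by
  by_cases hl : insert a (insert b S) ∈ deleteNone (faceComplex (extend v l))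
  · filter_upwards [self_mem_nhdsWithin] with s hs _
    exact (mem_deleteNone_extend_lexVec hs (by simp) (by simp)).2 hl
  have hlneg : ∀ h ∈ normalCone v (insert a S), v b h = 0 → h ≠ 0 → 0 < (-l) h := by
    intro h hh hb h0
    refine neg_pos.2 (neg_of_notMem_deleteNone hl ?_ h0)
    rw [Finset.insert_comm]
    exact mem_normalCone_insert.2 ⟨hh, hb⟩
  filter_upwards [eventually_pos_add_smul_of_isClosed_cone (isClosed_normalCone v (insert a S))
    (fun c hc h hh => smul_mem_normalCone hc hh) (fun h hh => hh.1 b) hlneg,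
    self_mem_nhdsWithin] with s hs (hs0 : 0 < s) haS
  obtain ⟨h, hh, h0, hnonneg⟩ := mem_deleteNone_faceComplex_extend.1 haS
  have := hs h hh h0
  rw [lexVec_apply, hh.2 a (by simp)] at hnonneg
  rw [LinearMap.neg_apply] at this
  nlinarith

variable [Fintype ι]

theorem GeneralPosition.eventually_insert_both_mem_linkNone_lexVec (hv : GeneralPosition v d) :
    ∀ᶠ s in 𝓝[>] (0 : ℝ), insert b S ∈ linkNone (faceComplex (extend v (lexVec v a b l s))) →
      insert a (insert b S) ∈ deleteNone (faceComplex (extend v (lexVec v a b l s))) →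
      insert a (insert b S) ∈ linkNone (faceComplex (extend v (lexVec v a b l s))) := by
  by_cases hB : insert a (insert b S) ∈ linkNone (faceComplex (extend v l))
  · filter_upwards [self_mem_nhdsWithin] with s hs _ _
    exact (mem_linkNone_extend_lexVec hs (by simp) (by simp)).2 hB
  by_cases hA : insert a (insert b S) ∈ deleteNone (faceComplex (extend v l))
  · have hpos : ∀ h ∈ normalCone v (insert b S), v a h = 0 → h ≠ 0 → 0 < l h :=
      fun h hh hah => hv.pos_of_notMem_linkNone hA hB h (mem_normalCone_insert.2 ⟨hh, hah⟩)
    have hsq : Tendsto (fun s : ℝ => s ^ 2) (𝓝[>] 0) (𝓝[>] 0) :=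
      tendsto_nhdsWithin_iff.2 ⟨(tendsto_nhdsWithin_of_tendsto_nhds
        ((continuous_pow 2).tendsto' 0 0 (by simp))), by
          filter_upwards [self_mem_nhdsWithin] with s hs using pow_pos (Set.mem_Ioi.1 hs) 2⟩
    filter_upwards [hsq.eventually (eventually_pos_add_smul_of_isClosed_cone
      (isClosed_normalCone v (insert b S)) (fun c hc h hh => smul_mem_normalCone hc hh)
      (fun h hh => hh.1 a) hpos)] with s hs hbS
    obtain ⟨h, hh, h0, hzero⟩ := mem_linkNone_faceComplex_extend.1 hbS
    rw [lexVec_apply, hh.2 b (by simp), mul_zero, sub_zero] at hzero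
    exact absurd hzero (hs h hh h0).ne'
  · filter_upwards [self_mem_nhdsWithin] with s hs _ hA'
    exact absurd ((mem_deleteNone_extend_lexVec hs (by simp) (by simp)).1 hA') hA

theorem GeneralPosition.eventually_lexStep (hv : GeneralPosition v d) (hab : a ≠ b)
    (l : Module.Dual ℝ W) :
    ∀ᶠ s in 𝓝[>] (0 : ℝ), LexStep (faceComplex v)
      (deleteNone (faceComplex (extend v (lexVec v a b l s))))
      (linkNone (faceComplex (extend v (lexVec v a b l s)))) a b := by
  filter_upwards [
    eventually_all.2 fun S => eventually_imp_distrib_left.2 fun ha : a ∉ S =>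
      eventually_imp_distrib_left.2 (hv.eventually_mem_deleteNone_lexVec (b := b) (l := l) ha),
    eventually_all.2 fun S => eventually_imp_distrib_left.2 fun ha : a ∉ S =>
      eventually_imp_distrib_left.2 fun hb : b ∉ S => eventually_imp_distrib_left.2
        (hv.eventually_mem_linkNone_lexVec (l := l) hab ha hb),
    eventually_all.2 (eventually_insert_mem_of_mem_linkNone_lexVec v l a b),
    eventually_all.2 fun S => eventually_imp_distrib_left.2 fun ha : a ∉ S =>
      eventually_imp_distrib_left.2
        (hv.eventually_insert_right_mem_linkNone_lexVec (l := l) hab ha),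
    eventually_all.2 fun S => hv.eventually_insert_both_mem_linkNone_lexVec (S := S),
    eventually_all.2 fun S => eventually_imp_distrib_left.2
      (hv.eventually_insert_left_mem_linkNone_lexVec (S := S) (l := l) hab),
    eventually_all.2 (eventually_insert_both_mem_deletion_lexVec v l a b)]
    with s h₁ h₂ h₃ h₄ h₅ h₆ h₇
  exact ⟨h₁, h₂, h₃, h₄, h₅, h₆, h₇⟩

end LexStep

section GenericExtension

variable {ι W : Type*} [AddCommGroup W] [Module ℝ W] [Fintype ι] {v : ι → Module.Dual ℝ W}
  {y l : Module.Dual ℝ W} {S : Finset ι} {f h : W} {d : ℕ}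

theorem GeneralPosition.extend_of_apply_ne_zero (hv : GeneralPosition v d)
    (hy : ∀ h : W, h ≠ 0 → ∀ S : Finset ι, S.card = d → (∀ i ∈ S, v i h = 0) → y h ≠ 0) :
    GeneralPosition (extend v y) d := by
  refine ⟨hv.finrank_eq, by simpa using hv.lt_card.trans (Nat.lt_succ_self _), fun h S hS hd => ?_⟩
  by_contra h0
  obtain ⟨T, rfl | rfl⟩ := exists_eq_map_some_or_eq_insertNone S
  · exact h0 (hv.eq_zero (S := T) (fun i hi => hS (some i) (by simpa using hi)) (by simpa using hd))
  · have hT : ∀ i ∈ T, v i h = 0 := fun i hi => hS (some i) (by simpa using hi)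
    have := hv.card_le h0 hT
    rw [Finset.card_insertNone] at hd
    exact hy h h0 T (by omega) hT (hS none (by simp))

theorem GeneralPosition.apply_ne_zero_of_extend (hl : GeneralPosition (extend v l) d)
    (h0 : h ≠ 0) (hS : S.card = d) (hh : ∀ i ∈ S, v i h = 0) : l h ≠ 0 := by
  refine fun hlh => h0 (hl.eq_zero (S := S.insertNone) ?_ (by simp [hS]))
  rintro (_ | i) hi
  · exact hlh
  · exact hh i (Finset.some_mem_insertNone.1 hi)

theorem GeneralPosition.exists_eq_smul (hv : GeneralPosition v d) (hS : S.card = d) (h0 : f ≠ 0)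
    (hf : ∀ i ∈ S, v i f = 0) (hh : ∀ i ∈ S, v i h = 0) : ∃ c : ℝ, h = c • f := by
  classical
  obtain ⟨i, hi⟩ : ∃ i, i ∉ S := by
    by_contra! hall
    have := hv.lt_card
    rw [← Finset.card_univ, ← Finset.eq_univ_of_forall hall] at this
    omega
  have hzero {g : W} (hg : ∀ j ∈ S, v j g = 0) (hig : v i g = 0) : g = 0 :=
    hv.eq_zero (S := insert i S) (by simpa [hig] using hg)
      (by rw [Finset.card_insert_of_notMem hi]; omega)
  have hif : v i f ≠ 0 := fun hif => h0 (hzero hf hif)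
  refine ⟨v i h / v i f, sub_eq_zero.1 (hzero (fun j hj => ?_) ?_)⟩
  · simp [hh j hj, hf j hj]
  · simp [hif]

theorem GeneralPosition.eventually_extend (hv : GeneralPosition v d) {y : ℝ → Module.Dual ℝ W}
    {F : Filter ℝ} (hy : ∀ h : W, h ≠ 0 → ∀ S : Finset ι, S.card = d → (∀ i ∈ S, v i h = 0) →
      ∀ᶠ s in F, y s h ≠ 0) :
    ∀ᶠ s in F, GeneralPosition (extend v (y s)) d := by
  have hne (S : Finset ι) : ∀ᶠ s in F, ∀ h : W, h ≠ 0 → S.card = d → (∀ i ∈ S, v i h = 0) →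
      y s h ≠ 0 := by
    by_cases hS : ∃ f : W, f ≠ 0 ∧ S.card = d ∧ ∀ i ∈ S, v i f = 0
    · obtain ⟨f, f0, hcard, hf⟩ := hS
      filter_upwards [hy f f0 S hcard hf] with s hs h h0 _ hh
      obtain ⟨c, rfl⟩ := hv.exists_eq_smul hcard f0 hf hh
      simpa [hs] using (smul_ne_zero_iff.1 h0).1
    · push Not at hS
      exact Eventually.of_forall fun s h h0 hcard hh =>
        absurd hh (by simpa using hS h h0 hcard)
  filter_upwards [eventually_all.2 hne] with s hs
  exact hv.extend_of_apply_ne_zero fun h h0 S => hs S h h0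

theorem eventually_eval_ne_zero {p : Polynomial ℝ} (hp : p ≠ 0) :
    ∀ᶠ s in 𝓝[>] (0 : ℝ), p.eval s ≠ 0 := by
  have hroots : {s | p.IsRoot s}.Finite := Polynomial.finite_setOfPred_isRoot hp
  exact nhdsWithin_mono 0 (fun s hs => ne_of_gt hs) (nhdsNE_le_cofinite 0 hroots.compl_mem_cofinite)

theorem GeneralPosition.eventually_extend_lexVec (hv : GeneralPosition v d)
    (hl : GeneralPosition (extend v l) d) (a b : ι) :
    ∀ᶠ s in 𝓝[>] (0 : ℝ), GeneralPosition (extend v (lexVec v a b l s)) d := by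
  refine hv.eventually_extend fun h h0 S hS hh => ?_
  let p : Polynomial ℝ := .C (l h) * .X ^ 2 + .C (-v b h) * .X + .C (v a h)
  have hp : p ≠ 0 := fun hzero => hl.apply_ne_zero_of_extend h0 hS hh <| by
    simpa [p] using congrArg (Polynomial.coeff · 2) hzero
  filter_upwards [eventually_eval_ne_zero hp] with s hs
  convert hs using 1
  simp [p, lexVec_apply]
  ring

/-- A generic point of the moment curve has positive coordinates that avoid any given finite set of
hyperplanes, so it yields a generic vector inside the cone spanned by `v`. -/
theorem GeneralPosition.exists_generic_interior (hv : GeneralPosition v d) :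
    ∃ y : Module.Dual ℝ W, GeneralPosition (extend v y) d ∧
      ∀ h : W, h ≠ 0 → (∀ i, 0 ≤ v i h) → 0 < y h := by
  let e := Fintype.equivFin ι
  let y (t : ℝ) : Module.Dual ℝ W := ∑ i, t ^ (e i : ℕ) • v i
  have hy (t : ℝ) (h : W) : y t h = ∑ i, t ^ (e i : ℕ) * v i h := by simp [y]
  have hgeneric : ∀ᶠ t in 𝓝[>] (0 : ℝ), GeneralPosition (extend v (y t)) d := by
    refine hv.eventually_extend fun h h0 _ _ _ => ?_
    let p : Polynomial ℝ := ∑ i, Polynomial.monomial (e i : ℕ) (v i h)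
    have hp : p ≠ 0 := by
      refine fun hzero => h0 (hv.eq_zero (S := Finset.univ) (fun i _ => ?_)
        (by simpa using hv.lt_card))
      have hcoeff : p.coeff (e i) = v i h := by
        simp only [p, Polynomial.finsetSum_coeff, Polynomial.coeff_monomial]
        rw [Finset.sum_eq_single i (fun j _ hj => if_neg fun hji => hj (e.injective (Fin.ext hji)))
          (by simp), if_pos rfl]
      rw [← hcoeff, hzero, Polynomial.coeff_zero]
    filter_upwards [eventually_eval_ne_zero hp] with t ht
    rw [hy]
    simpa [p, Polynomial.eval_finsetSum, mul_comm] using ht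
  obtain ⟨t, ht, ht0 : 0 < t⟩ := (hgeneric.and self_mem_nhdsWithin).exists
  refine ⟨y t, ht, fun h h0 hh => ?_⟩
  obtain ⟨i, hi⟩ := hv.exists_pos h0 hh
  rw [hy]
  exact Finset.sum_pos' (fun j _ => mul_nonneg (by positivity) (hh j))
    ⟨i, Finset.mem_univ i, by positivity⟩

end GenericExtension

section Sewing

variable {ι W : Type*} [NormedAddCommGroup W] [NormedSpace ℝ W] {v : ι → Module.Dual ℝ W}
  {y l : Module.Dual ℝ W} {a b : ι} {flag : List (ι × ι)} {d : ℕ} {s : ℝ}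

/-- The vertices of the edges of a flag. -/
def flagVertices (flag : List (ι × ι)) : List ι :=
  flag.flatMap fun p => [p.1, p.2]

theorem flagVertices_cons (p : ι × ι) (flag : List (ι × ι)) :
    flagVertices (p :: flag) = p.1 :: p.2 :: flagVertices flag :=
  rfl

theorem mem_flagVertices {i : ι} : i ∈ flagVertices flag ↔ ∃ p ∈ flag, i = p.1 ∨ i = p.2 := by
  simp [flagVertices]

theorem flagVertices_map {κ : Type*} (f : ι → κ) (flag : List (ι × ι)) :
    flagVertices (flag.map (Prod.map f f)) = (flagVertices flag).map f := by
  simp [flagVertices, List.flatMap_map, List.map_flatMap]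

variable [DecidableEq ι]

theorem link_deleteNone_extend_lexVec (hs : 0 < s) :
    link (deleteNone (faceComplex (extend v (lexVec v a b l s)))) {a, b} =
      link (deleteNone (faceComplex (extend v l))) {a, b} :=
  Set.ext fun _ => mem_deleteNone_extend_lexVec hs (by simp) (by simp)

theorem link_linkNone_extend_lexVec (hs : 0 < s) :
    link (linkNone (faceComplex (extend v (lexVec v a b l s)))) {a, b} =
      link (linkNone (faceComplex (extend v l))) {a, b} :=
  Set.ext fun _ => mem_linkNone_extend_lexVec hs (by simp) (by simp)

variable [FiniteDimensional ℝ W] [Fintype ι]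

theorem GeneralPosition.exists_lexChain (hv : GeneralPosition v d)
    (hflag : (flagVertices flag).Nodup) :
    ∃ y : Module.Dual ℝ W, GeneralPosition (extend v y) d ∧
      LexChain (faceComplex v) (deleteNone (faceComplex (extend v y)))
        (linkNone (faceComplex (extend v y))) flag := by
  induction flag with
  | nil =>
    obtain ⟨y, hy, hpos⟩ := hv.exists_generic_interior
    refine ⟨y, hy, ?_, ?_⟩
    · rintro S ⟨h, hh, h0⟩
      exact mem_deleteNone_faceComplex_extend.2 ⟨h, hh, h0, (hpos h h0 hh.1).le⟩
    · refine Set.eq_empty_of_forall_notMem fun S hS => ?_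
      obtain ⟨h, hh, h0, hzero⟩ := mem_linkNone_faceComplex_extend.1 hS
      exact (hpos h h0 hh.1).ne' hzero
  | cons p flag ih =>
    obtain ⟨a, b⟩ := p
    rw [flagVertices_cons] at hflag
    simp only [List.nodup_cons, List.mem_cons, not_or] at hflag
    obtain ⟨⟨hab, ha⟩, hb, hflag⟩ := hflag
    obtain ⟨l, hl, hchain⟩ := ih hflag
    obtain ⟨s, ⟨hgeneral, hstep⟩, hs : 0 < s⟩ := ((hv.eventually_extend_lexVec hl a b).and
      (hv.eventually_lexStep hab l)).and self_mem_nhdsWithin |>.exists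
    refine ⟨lexVec v a b l s, hgeneral, hstep, ?_⟩
    rw [link_deleteNone_extend_lexVec hs, link_linkNone_extend_lexVec hs]
    refine hchain.link_of_notMem fun p hp => ?_
    have hp₁ : p.1 ∈ flagVertices flag := mem_flagVertices.2 ⟨p, hp, Or.inl rfl⟩
    have hp₂ : p.2 ∈ flagVertices flag := mem_flagVertices.2 ⟨p, hp, Or.inr rfl⟩
    simp only [Finset.mem_insert, Finset.mem_singleton]
    grind

theorem GeneralPosition.exists_extend_isSewingFlag (hv : GeneralPosition v d)
    (hnodup : (flagVertices flag).Nodup) (hflag : IsSewingFlag (faceComplex v) flag)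
    (hmissing : MissingFacesLE Set.univ (faceComplex v) (flag.length + 1)) :
    ∃ y : Module.Dual ℝ W, GeneralPosition (extend v y) d ∧
      IsSewingFlag (faceComplex (extend v y)) (flag.map (Prod.map some some)) ∧
      MissingFacesLE Set.univ (faceComplex (extend v y)) (flag.length + 1) := by
  obtain ⟨y, hy, hchain⟩ := hv.exists_lexChain hnodup
  have hK₀ := isLowerSet_faceComplex v
  have hK := isLowerSet_faceComplex (extend v y)
  exact ⟨y, hy, hchain.isSewingFlag hflag hK₀ hK deleteNone_faceComplex_extend_subset,
    hchain.missingFacesLE hflag hK₀ hK deleteNone_faceComplex_extend_subset hmissing⟩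

end Sewing

theorem GeneralPosition.exists_card_eq_add {ι : Type} {W : Type*} [NormedAddCommGroup W]
    [NormedSpace ℝ W] [FiniteDimensional ℝ W] [DecidableEq ι] [Fintype ι]
    {v : ι → Module.Dual ℝ W} {flag : List (ι × ι)} {d : ℕ} (hv : GeneralPosition v d)
    (hnodup : (flagVertices flag).Nodup) (hflag : IsSewingFlag (faceComplex v) flag)
    (hmissing : MissingFacesLE Set.univ (faceComplex v) (flag.length + 1)) (m : ℕ) :
    ∃ (κ : Type) (_ : Fintype κ) (w : κ → Module.Dual ℝ W),
      Fintype.card κ = Fintype.card ι + m ∧ GeneralPosition w d ∧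
      (∀ G : Finset κ, G.card ≤ flag.length → G ∈ faceComplex w) ∧
      MissingFacesLE Set.univ (faceComplex w) (flag.length + 1) := by
  induction m generalizing ι v flag with
  | zero => exact ⟨ι, ‹_›, v, rfl, hv, fun _ => hflag.mem_of_card_le, hmissing⟩
  | succ m ih =>
    obtain ⟨y, hy, hflag', hmissing'⟩ := hv.exists_extend_isSewingFlag hnodup hflag hmissing
    have hlength : (flag.map (Prod.map some some)).length = flag.length := List.length_map _
    rw [← hlength] at hmissing' ⊢
    obtain ⟨κ, _, w, hcard, hw⟩ := ih hy
      (by rw [flagVertices_map]; exact hnodup.map (Option.some_injective ι)) hflag' hmissing'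
    exact ⟨κ, _, w, by rw [hcard, Fintype.card_option]; omega, hw⟩

section AffineConfig

variable {ι E : Type*} [NormedAddCommGroup E] [NormedSpace ℝ E] {x : ι → E}
  {h : ℝ × StrongDual ℝ E} {d : ℕ}

/-- The vector configuration obtained by lifting the points `x i` to height one. A pair `(c, l)`
stands for the affine functional `p ↦ c + l p`. -/
noncomputable def affineConfig (x : ι → E) (i : ι) : Module.Dual ℝ (ℝ × StrongDual ℝ E) :=
  LinearMap.coprod LinearMap.id (ContinuousLinearMap.apply ℝ ℝ (x i)).toLinearMap

/-- The face of the convex hull of the points `x i` on which the affine functional `h` vanishes. -/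
def supportingFace (x : ι → E) (h : ℝ × StrongDual ℝ E) : Set E :=
  {p ∈ convexHull ℝ (Set.range x) | h.1 + h.2 p = 0}

theorem affineConfig_apply (i : ι) : affineConfig x i h = h.1 + h.2 (x i) := rfl

theorem mem_supportingFace {i : ι} : x i ∈ supportingFace x h ↔ affineConfig x i h = 0 :=
  and_iff_right (subset_convexHull ℝ _ ⟨i, rfl⟩)

theorem nonneg_of_mem_convexHull (hh : ∀ i, 0 ≤ affineConfig x i h) {p : E}
    (hp : p ∈ convexHull ℝ (Set.range x)) : 0 ≤ h.1 + h.2 p := by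
  have hconvex : Convex ℝ {p | -h.1 ≤ h.2 p} := convex_halfSpace_ge h.2.isLinear (-h.1)
  refine neg_le_iff_add_nonneg'.1 (convexHull_min ?_ hconvex hp)
  rintro _ ⟨i, rfl⟩
  exact neg_le_iff_add_nonneg'.2 (hh i)

theorem isExposed_supportingFace (hh : ∀ i, 0 ≤ affineConfig x i h) :
    IsExposed ℝ (convexHull ℝ (Set.range x)) (supportingFace x h) := by
  rintro ⟨z, hz, hz0⟩
  refine ⟨-h.2, Set.ext fun p => and_congr_right fun hp => ⟨fun hp0 q hq => ?_, fun hmax => ?_⟩⟩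
  · rw [neg_apply, neg_apply]
    linarith [nonneg_of_mem_convexHull hh hq]
  · refine le_antisymm ?_ (nonneg_of_mem_convexHull hh hp)
    have := hmax z hz
    rw [neg_apply, neg_apply] at this
    linarith

theorem supportingFace_eq_convexHull [Finite ι] (hh : ∀ i, 0 ≤ affineConfig x i h) :
    supportingFace x h = convexHull ℝ (x '' {i | affineConfig x i h = 0}) := by
  have hexposed := isExposed_supportingFace hh
  refine Set.Subset.antisymm ?_ (convexHull_min ?_ (hexposed.convex (convex_convexHull ℝ _)))
  · have hcompact := hexposed.isCompact ((Set.finite_range x).isCompact_convexHull ℝ)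
    rw [← closure_convexHull_extremePoints hcompact (hexposed.convex (convex_convexHull ℝ _))]
    refine closure_minimal (convexHull_mono ?_) ((Set.toFinite _).isClosed_convexHull ℝ)
    rw [hexposed.isExtreme.extremePoints_eq]
    rintro _ ⟨hp, hextreme⟩
    obtain ⟨i, rfl⟩ := extremePoints_convexHull_subset hextreme
    exact ⟨i, mem_supportingFace.1 hp, rfl⟩
  · rintro _ ⟨i, hi, rfl⟩
    exact mem_supportingFace.2 hi

theorem exists_eq_supportingFace [Nonempty ι] {F : Set E}
    (hF : IsProperFace (convexHull ℝ (Set.range x)) F) :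
    ∃ h ≠ 0, (∀ i, 0 ≤ affineConfig x i h) ∧ F = supportingFace x h := by
  obtain ⟨hexposed, hproper⟩ := hF
  rcases F.eq_empty_or_nonempty with rfl | hne
  · exact ⟨(1, 0), by simp, fun i => by simp [affineConfig_apply], by simp [supportingFace]⟩
  obtain ⟨l, rfl⟩ := hexposed hne
  obtain ⟨p, hp, hmax⟩ := hne
  have hface : {q ∈ convexHull ℝ (Set.range x) | ∀ r ∈ convexHull ℝ (Set.range x), l r ≤ l q} =
      supportingFace x (l p, -l) := by
    refine Set.ext fun q => and_congr_right fun hq => ⟨fun hqmax => ?_, fun hpq r hr => ?_⟩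
    · simpa [← sub_eq_add_neg, sub_eq_zero] using (hqmax p hp).antisymm (hmax q hq)
    · have : l p = l q := by simpa [← sub_eq_add_neg, sub_eq_zero] using hpq
      exact this ▸ hmax r hr
  refine ⟨_, fun h0 => hproper ?_, fun i => ?_, hface⟩
  · rw [hface, h0]
    simp [supportingFace]
  · simpa [affineConfig_apply, ← sub_eq_add_neg] using hmax (x i) (subset_convexHull ℝ _ ⟨i, rfl⟩)

section GeneralPosition

variable [Fintype ι]

theorem GeneralPosition.nonempty {W : Type*} [AddCommGroup W] [Module ℝ W]
    {v : ι → Module.Dual ℝ W} (hv : GeneralPosition v d) : Nonempty ι :=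
  Fintype.card_pos_iff.1 (Nat.zero_lt_of_lt hv.lt_card)

theorem GeneralPosition.affineIndependent (hx : GeneralPosition (affineConfig x) d) {S : Finset ι}
    (hS : S.card ≤ d + 1) : AffineIndependent ℝ fun i : S => x i := by
  classical
  rw [affineIndependent_iff]
  intro s w hw hwx j hj
  obtain ⟨g, hg⟩ := hx.exists_eval_eq hS (Pi.single (j : ι) 1)
  calc w j = ∑ i ∈ s, w i * affineConfig x i g := by
        rw [Finset.sum_eq_single_of_mem j hj fun i _ hij => by
          rw [hg i i.2, Pi.single_eq_of_ne (Subtype.coe_injective.ne hij), mul_zero]]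
        simp [hg j j.2]
    _ = g.1 * ∑ i ∈ s, w i + g.2 (∑ i ∈ s, w i • x i) := by
        simp only [affineConfig_apply, mul_add, Finset.sum_add_distrib, map_sum, map_smul,
          smul_eq_mul, Finset.mul_sum, mul_comm]
    _ = 0 := by rw [hw, hwx, map_zero, mul_zero, add_zero]

theorem GeneralPosition.injective (hx : GeneralPosition (affineConfig x) d) (hd : 1 ≤ d) :
    Function.Injective x := by
  classical
  intro i j hij
  have := (hx.affineIndependent (S := {i, j}) (Finset.card_le_two.trans (by omega))).injective
    (a₁ := ⟨i, by simp⟩) (a₂ := ⟨j, by simp⟩) hij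
  simpa using this

theorem GeneralPosition.isSimplex_supportingFace (hx : GeneralPosition (affineConfig x) d)
    (h0 : h ≠ 0) (hh : ∀ i, 0 ≤ affineConfig x i h) : IsSimplex (supportingFace x h) := by
  classical
  let Z : Finset ι := {i | affineConfig x i h = 0}
  have hZ : Z.card ≤ d := hx.card_le h0 fun i hi => (Finset.mem_filter.1 hi).2
  refine ⟨Z.image x, ?_, by simp [supportingFace_eq_convexHull hh, Z]⟩
  refine (hx.affineIndependent (hZ.trans (by omega))).range.mono ?_
  simp [Set.subset_def, Z]

theorem GeneralPosition.isSimplicial (hx : GeneralPosition (affineConfig x) d) :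
    IsSimplicial (convexHull ℝ (Set.range x)) := by
  intro F hF
  have := hx.nonempty
  obtain ⟨h, h0, hh, rfl⟩ := exists_eq_supportingFace hF
  exact hx.isSimplex_supportingFace h0 hh

theorem GeneralPosition.exists_zeros_eq (hx : GeneralPosition (affineConfig x) d) {S : Finset ι}
    (hS : S ∈ faceComplex (affineConfig x)) :
    ∃ h ≠ 0, (∀ i, 0 ≤ affineConfig x i h) ∧ {i | affineConfig x i h = 0} = (S : Set ι) := by
  obtain ⟨h, hh, h0, hpos⟩ := hx.exists_strict hS
  exact ⟨h, h0, hh.1, Set.ext fun i => ⟨fun hi => by_contra fun hiS => (hpos i hiS).ne' hi, hh.2 i⟩⟩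

theorem GeneralPosition.mem_vertices (hx : GeneralPosition (affineConfig x) d) {i : ι}
    (hi : {i} ∈ faceComplex (affineConfig x)) : x i ∈ vertices (convexHull ℝ (Set.range x)) := by
  obtain ⟨h, -, hh, hzero⟩ := hx.exists_zeros_eq hi
  have hface : supportingFace x h = {x i} := by
    rw [supportingFace_eq_convexHull hh, hzero, Finset.coe_singleton, Set.image_singleton,
      convexHull_singleton]
  exact isExtreme_singleton.1 (hface ▸ (isExposed_supportingFace hh).isExtreme)

theorem GeneralPosition.vertices_convexHull (hx : GeneralPosition (affineConfig x) d)
    (h1 : ∀ i, {i} ∈ faceComplex (affineConfig x)) :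
    vertices (convexHull ℝ (Set.range x)) = Set.range x :=
  extremePoints_convexHull_subset.antisymm (Set.range_subset_iff.2 fun i => hx.mem_vertices (h1 i))

theorem GeneralPosition.vertices_supportingFace (hx : GeneralPosition (affineConfig x) d)
    (h0 : h ≠ 0) (hh : ∀ i, 0 ≤ affineConfig x i h) :
    vertices (supportingFace x h) = x '' {i | affineConfig x i h = 0} := by
  rw [vertices, (isExposed_supportingFace hh).isExtreme.extremePoints_eq]
  refine Set.Subset.antisymm ?_ ?_
  · rintro _ ⟨hp, hextreme⟩
    obtain ⟨i, rfl⟩ := extremePoints_convexHull_subset hextreme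
    exact ⟨i, mem_supportingFace.1 hp, rfl⟩
  · rintro _ ⟨i, hi, rfl⟩
    have hvertex : {i} ∈ faceComplex (affineConfig x) := ⟨h, ⟨hh, by simpa using hi⟩, h0⟩
    exact ⟨mem_supportingFace.2 hi, hx.mem_vertices hvertex⟩

theorem GeneralPosition.isProperFace_supportingFace (hx : GeneralPosition (affineConfig x) d)
    (h0 : h ≠ 0) (hh : ∀ i, 0 ≤ affineConfig x i h) :
    IsProperFace (convexHull ℝ (Set.range x)) (supportingFace x h) := by
  refine ⟨isExposed_supportingFace hh, fun heq => ?_⟩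
  obtain ⟨i, hi⟩ := hx.exists_pos h0 hh
  exact hi.ne' (mem_supportingFace.1 (heq ▸ subset_convexHull ℝ _ ⟨i, rfl⟩))

theorem GeneralPosition.mem_boundaryComplex_iff (hx : GeneralPosition (affineConfig x) d)
    {s : Finset E} : s ∈ boundaryComplex (convexHull ℝ (Set.range x)) ↔
      ∃ S ∈ faceComplex (affineConfig x), (s : Set E) = x '' S := by
  classical
  have := hx.nonempty
  constructor
  · rintro ⟨F, hF, hs⟩
    obtain ⟨h, h0, hh, rfl⟩ := exists_eq_supportingFace hF
    refine ⟨({i | affineConfig x i h = 0} : Finset ι), ⟨h, ⟨hh, by simp⟩, h0⟩, ?_⟩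
    simpa [hx.vertices_supportingFace h0 hh] using hs
  · rintro ⟨S, hS, hs⟩
    obtain ⟨h, h0, hh, hzero⟩ := hx.exists_zeros_eq hS
    exact ⟨_, hx.isProperFace_supportingFace h0 hh,
      by rw [hs, hx.vertices_supportingFace h0 hh, hzero]⟩

theorem GeneralPosition.finrank_point_space [FiniteDimensional ℝ E]
    (hx : GeneralPosition (affineConfig x) d) : Module.finrank ℝ E = d := by
  have hdual : Module.finrank ℝ (StrongDual ℝ E) = Module.finrank ℝ E := by
    rw [← LinearMap.toContinuousLinearMap.finrank_eq]
    exact Subspace.dual_finrank_eq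
  have := hx.finrank_eq
  rw [Module.finrank_prod, Module.finrank_self, hdual] at this
  omega

theorem GeneralPosition.dim_convexHull [FiniteDimensional ℝ E]
    (hx : GeneralPosition (affineConfig x) d) : dim (convexHull ℝ (Set.range x)) = d := by
  obtain ⟨i₀⟩ := hx.nonempty
  suffices htop : vectorSpan ℝ (convexHull ℝ (Set.range x)) = ⊤ by
    rw [dim, htop, finrank_top, hx.finrank_point_space]
  by_contra hne
  obtain ⟨f, f0, hf⟩ := Submodule.exists_le_ker_of_lt_top _ (lt_top_iff_ne_top.2 hne)
  have hzero : ((-f (x i₀), LinearMap.toContinuousLinearMap f) : ℝ × StrongDual ℝ E) = 0 := by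
    refine hx.eq_zero (S := Finset.univ) (fun i _ => ?_) (by simpa using hx.lt_card)
    have := hf (vsub_mem_vectorSpan ℝ (subset_convexHull ℝ _ ⟨i, rfl⟩)
      (subset_convexHull ℝ _ ⟨i₀, rfl⟩))
    simpa [affineConfig_apply, sub_eq_neg_add] using this
  exact f0 (by simpa using congrArg Prod.snd hzero)

end GeneralPosition

end AffineConfig

section Realization

theorem faceComplex_eq_of_linearEquiv {ι V W : Type*} [AddCommGroup V] [Module ℝ V]
    [AddCommGroup W] [Module ℝ W] {v : ι → Module.Dual ℝ V} {w : ι → Module.Dual ℝ W} {c : ι → ℝ}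
    (e : V ≃ₗ[ℝ] W) (hc : ∀ i, 0 < c i) (he : ∀ i h, w i (e h) = c i * v i h) :
    faceComplex v = faceComplex w := by
  ext S
  refine e.toEquiv.exists_congr fun h => ?_
  simp [normalCone, he, hc, (hc _).ne']

theorem GeneralPosition.of_linearEquiv {ι V W : Type*} [Fintype ι] [AddCommGroup V] [Module ℝ V]
    [AddCommGroup W] [Module ℝ W] {v : ι → Module.Dual ℝ V} {w : ι → Module.Dual ℝ W} {c : ι → ℝ}
    {d : ℕ} (hw : GeneralPosition w d) (e : V ≃ₗ[ℝ] W) (he : ∀ i h, w i (e h) = c i * v i h) :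
    GeneralPosition v d where
  finrank_eq := e.finrank_eq.trans hw.finrank_eq
  lt_card := hw.lt_card
  eq_zero h _ hS hcard :=
    e.map_eq_zero_iff.1 (hw.eq_zero (fun i hi => by rw [he, hS i hi, mul_zero]) hcard)

/-- The points are the intersections of the rays through the vectors `v i` with the hyperplane on
which the functional `f` is one. -/
theorem exists_affineConfig_linearEquiv {ι W E : Type*} [AddCommGroup W] [Module ℝ W]
    [FiniteDimensional ℝ W] [NormedAddCommGroup E] [NormedSpace ℝ E] [FiniteDimensional ℝ E]
    {v : ι → Module.Dual ℝ W} {f : W} (hW : Module.finrank ℝ W = Module.finrank ℝ E + 1)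
    (f0 : f ≠ 0) (hf : ∀ i, v i f ≠ 0) :
    ∃ (x : ι → E) (e : (ℝ × StrongDual ℝ E) ≃ₗ[ℝ] W),
      ∀ i h, v i (e h) = v i f * affineConfig x i h := by
  obtain ⟨Q, hQ⟩ := Submodule.exists_isCompl (Submodule.span ℝ {f})
  have hfinrank : Module.finrank ℝ (Module.Dual ℝ E) = Module.finrank ℝ Q := by
    have := Submodule.finrank_add_eq_of_isCompl hQ
    rw [finrank_span_singleton f0] at this
    rw [Subspace.dual_finrank_eq]
    omega
  let e₂ : StrongDual ℝ E ≃ₗ[ℝ] Q :=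
    LinearMap.toContinuousLinearMap.symm.trans (LinearEquiv.ofFinrankEq _ _ hfinrank)
  let e : (ℝ × StrongDual ℝ E) ≃ₗ[ℝ] W :=
    ((LinearEquiv.toSpanNonzeroSingleton ℝ W f f0).prodCongr e₂).trans
      (Submodule.prodEquivOfIsCompl _ _ hQ)
  have he (h) : e h = h.1 • f + e₂ h.2 := by
    simp [e, LinearEquiv.toSpanNonzeroSingleton_apply]
  let y (i : ι) : Module.Dual ℝ (Module.Dual ℝ E) :=
    (v i f)⁻¹ • (v i ∘ₗ Q.subtype ∘ₗ e₂.toLinearMap ∘ₗ LinearMap.toContinuousLinearMap.toLinearMap)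
  refine ⟨fun i => (Module.evalEquiv ℝ E).symm (y i), e, fun i h => ?_⟩
  have hx : h.2 ((Module.evalEquiv ℝ E).symm (y i)) = (v i f)⁻¹ * v i (e₂ h.2) :=
    Module.apply_evalEquiv_symm_apply (R := ℝ) (M := E) h.2 (y i)
  rw [he, affineConfig_apply, hx, map_add, map_smul, smul_eq_mul, mul_add,
    mul_inv_cancel_left₀ (hf i), mul_comm]

theorem GeneralPosition.exists_affineConfig {ι W E : Type*} [Fintype ι] [AddCommGroup W]
    [Module ℝ W] [NormedAddCommGroup E] [NormedSpace ℝ E] [FiniteDimensional ℝ E]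
    {v : ι → Module.Dual ℝ W} (hv : GeneralPosition v (Module.finrank ℝ E))
    (hempty : ∅ ∈ faceComplex v) :
    ∃ x : ι → E, GeneralPosition (affineConfig x) (Module.finrank ℝ E) ∧
      faceComplex (affineConfig x) = faceComplex v := by
  have : FiniteDimensional ℝ W := Module.finite_of_finrank_pos (by rw [hv.finrank_eq]; omega)
  obtain ⟨f, -, f0, hf⟩ := hv.exists_strict hempty
  replace hf (i) : 0 < v i f := hf i (Finset.notMem_empty i)
  obtain ⟨x, e, he⟩ := exists_affineConfig_linearEquiv hv.finrank_eq f0 fun i => (hf i).ne'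
  exact ⟨x, hv.of_linearEquiv e he, faceComplex_eq_of_linearEquiv e hf he⟩

section Polytope

variable {ι E : Type*} [NormedAddCommGroup E] [NormedSpace ℝ E] {x : ι ↪ E} {d m : ℕ}

theorem IsMissingFace.exists_eq_map {M : Finset E}
    (hM : IsMissingFace (convexHull ℝ (Set.range x)) M) : ∃ S : Finset ι, M = S.map x := by
  refine ⟨M.preimage x x.injective.injOn, ?_⟩
  rw [← Finset.coe_inj, Finset.coe_map, Finset.coe_preimage,
    Set.image_preimage_eq_of_subset (hM.1.trans extremePoints_convexHull_subset)]

variable [Fintype ι]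

theorem GeneralPosition.boundaryComplex_convexHull (hx : GeneralPosition (affineConfig x) d) :
    boundaryComplex (convexHull ℝ (Set.range x)) =
      Finset.map x '' faceComplex (affineConfig x) := by
  ext s
  rw [hx.mem_boundaryComplex_iff]
  refine exists_congr fun S => and_congr_right fun _ => ?_
  rw [← Finset.coe_map, Finset.coe_inj, eq_comm]

theorem GeneralPosition.map_mem_boundaryComplex (hx : GeneralPosition (affineConfig x) d)
    {S : Finset ι} : S.map x ∈ boundaryComplex (convexHull ℝ (Set.range x)) ↔
      S ∈ faceComplex (affineConfig x) := by
  rw [hx.boundaryComplex_convexHull, (Finset.map_injective x).mem_set_image]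

theorem GeneralPosition.faceCount_convexHull (hx : GeneralPosition (affineConfig x) d) {j : ℕ}
    (hj : ∀ S : Finset ι, S.card = j → S ∈ faceComplex (affineConfig x)) :
    faceCount (convexHull ℝ (Set.range x)) j = (Fintype.card ι).choose j := by
  have hfaces : {s | s ∈ boundaryComplex (convexHull ℝ (Set.range x)) ∧ s.card = j} =
      Finset.map x '' (Finset.powersetCard j Finset.univ : Finset (Finset ι)) := by
    rw [hx.boundaryComplex_convexHull]
    ext s
    constructor
    · rintro ⟨⟨S, -, rfl⟩, hcard⟩
      exact ⟨S, by simpa using hcard, rfl⟩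
    · rintro ⟨S, hS, rfl⟩
      have hcard : S.card = j := by simpa using hS
      exact ⟨⟨S, hj S hcard, rfl⟩, by rwa [Finset.card_map]⟩
  rw [faceCount, hfaces, Set.ncard_image_of_injective _ (Finset.map_injective x),
    Set.ncard_coe_finset, Finset.card_powersetCard, Finset.card_univ]

theorem GeneralPosition.card_le_of_isMissingFace (hx : GeneralPosition (affineConfig x) d)
    (hmissing : MissingFacesLE Set.univ (faceComplex (affineConfig x)) m) {M : Finset E}
    (hM : IsMissingFace (convexHull ℝ (Set.range x)) M) : M.card ≤ m := by
  obtain ⟨S, rfl⟩ := hM.exists_eq_map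
  obtain ⟨-, hS, hfaces⟩ := hM
  rw [hx.map_mem_boundaryComplex] at hS
  obtain ⟨T, hTS, hT, hTface⟩ := hmissing (Set.mem_univ S) hS
  rcases hTS.eq_or_ssubset with rfl | hlt
  · rwa [Finset.card_map]
  · exact absurd (hx.map_mem_boundaryComplex.1 (hfaces _ (Finset.map_ssubset_map.2 hlt))) hTface

theorem GeneralPosition.lt_card_of_isMissingFace (hx : GeneralPosition (affineConfig x) d)
    (hneighborly : ∀ S : Finset ι, S.card ≤ m → S ∈ faceComplex (affineConfig x)) {M : Finset E}
    (hM : IsMissingFace (convexHull ℝ (Set.range x)) M) : m < M.card := by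
  obtain ⟨S, rfl⟩ := hM.exists_eq_map
  rw [Finset.card_map]
  exact not_le.1 fun hS => hM.2.1 (hx.map_mem_boundaryComplex.2 (hneighborly S hS))

theorem GeneralPosition.isNeighborly_convexHull [FiniteDimensional ℝ E]
    (hx : GeneralPosition (affineConfig x) d) (hd : 1 ≤ d / 2)
    (hneighborly : ∀ S : Finset ι, S.card ≤ d / 2 → S ∈ faceComplex (affineConfig x)) :
    IsNeighborly (convexHull ℝ (Set.range x)) := by
  refine ⟨⟨Finset.univ.map x, by simp⟩, hx.isSimplicial, ?_⟩
  rw [IsNeighborlyOfOrder, hx.dim_convexHull,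
    hx.faceCount_convexHull fun S hS => hneighborly S hS.le,
    hx.faceCount_convexHull fun S hS => hneighborly S (hS.le.trans hd), Nat.choose_one_right]

end Polytope

theorem GeneralPosition.exists_neighborly_polytope {ι W E : Type*} [Fintype ι] [AddCommGroup W]
    [Module ℝ W] [NormedAddCommGroup E] [NormedSpace ℝ E] [FiniteDimensional ℝ E]
    {v : ι → Module.Dual ℝ W} {k : ℕ} (hk : 1 ≤ k) (hE : Module.finrank ℝ E = 2 * k + 1)
    (hv : GeneralPosition v (2 * k + 1))
    (hneighborly : ∀ S : Finset ι, S.card ≤ k → S ∈ faceComplex v)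
    (hmissing : MissingFacesLE Set.univ (faceComplex v) (k + 1)) :
    ∃ P : Set E, IsNeighborly P ∧ dim P = 2 * k + 1 ∧ (vertices P).ncard = Fintype.card ι ∧
      (∀ M : Finset E, IsMissingFace P M → M.card = k + 1) ∧ missingFaceCount P (k + 1) = 0 := by
  have hempty : ∅ ∈ faceComplex v := hneighborly ∅ (Nat.zero_le k)
  rw [← hE] at hv ⊢
  obtain ⟨x, hx, hfaces⟩ := hv.exists_affineConfig (E := E) hempty
  have hinj := hx.injective (by omega)
  lift x to ι ↪ E using hinj
  rw [← hfaces] at hneighborly hmissing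
  have hvertex (i : ι) : {i} ∈ faceComplex (affineConfig x) := hneighborly {i} (by simpa using hk)
  have hcard : ∀ M : Finset E, IsMissingFace (convexHull ℝ (Set.range x)) M → M.card = k + 1 :=
    fun M hM => (hx.card_le_of_isMissingFace hmissing hM).antisymm
      (hx.lt_card_of_isMissingFace hneighborly hM)
  refine ⟨convexHull ℝ (Set.range x), hx.isNeighborly_convexHull (by omega) fun S hS =>
    hneighborly S (by omega), hx.dim_convexHull, ?_, hcard, ?_⟩
  · rw [hx.vertices_convexHull hvertex, ← Set.image_univ,
      Set.ncard_image_of_injective _ x.injective, Set.ncard_univ, Nat.card_eq_fintype_card]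
  · have hnone : {M | IsMissingFace (convexHull ℝ (Set.range x)) M ∧ M.card = k + 1 + 1} = ∅ :=
      Set.eq_empty_of_forall_notMem fun M hM => by
        have := hcard M hM.1
        have := hM.2
        omega
    rw [missingFaceCount, hnone, Set.ncard_empty]

end Realization

section SewingFlagOfMissingFaces

variable {ι : Type*} [DecidableEq ι] {K : Set (Finset ι)} {a b : ι} {flag : List (ι × ι)} {m : ℕ}

theorem MissingFacesLE.link (h : MissingFacesLE Set.univ K (m + 1)) (hK : IsLowerSet K)
    (F : Finset ι) : MissingFacesLE K (link K F) m := by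
  intro G hG hFG
  obtain ⟨M, hMG, hM, hMK⟩ := h (Set.mem_univ (F ∪ G)) hFG
  have hMF : ¬Disjoint M F := fun hdisj =>
    hMK (hK (hdisj.left_le_of_le_sup_left hMG) hG)
  refine ⟨M \ F, sdiff_le_iff.2 hMG, ?_, fun hM' => hMK (hK ?_ hM')⟩
  · have := Finset.card_sdiff_add_card_inter M F
    have := Finset.card_pos.2 (Finset.not_disjoint_iff_nonempty_inter.1 hMF)
    omega
  · exact Finset.subset_union_right.trans_eq Finset.union_sdiff_self_eq_union.symm

theorem missingFacesLE_link_link_singleton {B : Finset ι} (hK : IsLowerSet K) (ha : a ∈ B)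
    (hab : a ≠ b)
    (h : ∀ G ∉ K, ∃ M ⊆ G, M.card ≤ m + 2 ∧ M ∉ K ∧ (b ∈ M → a ∈ M)) :
    MissingFacesLE (ConvexPolytope.link K B)
      (ConvexPolytope.link (ConvexPolytope.link K B) {b}) m := by
  intro G hG hbG
  obtain ⟨M, hMG, hM, hMK, hbaM⟩ := h (B ∪ ({b} ∪ G)) hbG
  have hbM : b ∈ M := by
    by_contra hbM
    refine hMK (hK (fun i hi => ?_) hG)
    grind
  refine ⟨M \ ({b} ∪ B), by grind, ?_, fun hM' => hMK (hK (fun i hi => ?_) hM')⟩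
  · have hsub : M \ ({b} ∪ B) ⊆ M \ {a, b} := Finset.sdiff_subset_sdiff le_rfl (by grind)
    have hcard : (M \ {a, b}).card = M.card - 2 := by
      rw [Finset.card_sdiff_of_subset (by grind), Finset.card_pair hab]
    have := Finset.card_le_card hsub
    omega
  · grind

theorem isSewingFlag_cons (hK : IsLowerSet K)
    (hneighborly : ∀ G : Finset ι, G.card ≤ flag.length + 1 → G ∈ K)
    (hmissing : MissingFacesLE Set.univ K (flag.length + 2))
    (hflag : IsSewingFlag (ConvexPolytope.link K {a, b}) flag) : IsSewingFlag K ((a, b) :: flag) :=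
  ⟨hneighborly, hmissing.link hK {a}, hmissing.link hK {a, b}, hflag⟩

end SewingFlagOfMissingFaces

section GaleDual

variable {ι V : Type*} [Fintype ι] [AddCommGroup V] [Module ℝ V] {w : ι → V} {S : Finset ι} {d : ℕ}

/-- The space of linear dependences of the family `w`. -/
abbrev dependences (w : ι → V) : Submodule ℝ (ι → ℝ) :=
  LinearMap.ker (Fintype.linearCombination ℝ w)

/-- The Gale dual of the family `w`: the coordinate functionals on its linear dependences. -/
def galeDual (w : ι → V) (i : ι) : Module.Dual ℝ (dependences w) :=
  LinearMap.proj i ∘ₗ (dependences w).subtype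

theorem mem_dependences {h : ι → ℝ} : h ∈ dependences w ↔ ∑ i, h i • w i = 0 := by
  rw [LinearMap.mem_ker, Fintype.linearCombination_apply]

theorem mem_faceComplex_galeDual {h : ι → ℝ} (h0 : h ≠ 0) (hpos : ∀ i, 0 ≤ h i)
    (hw : ∑ i, h i • w i = 0) (hS : ∀ i ∈ S, h i = 0) : S ∈ faceComplex (galeDual w) :=
  ⟨⟨h, mem_dependences.2 hw⟩, ⟨hpos, hS⟩, fun hzero => h0 (congrArg Subtype.val hzero)⟩

theorem notMem_faceComplex_galeDual (u : Module.Dual ℝ V) (hu : ∀ i ∉ S, 0 < u (w i)) :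
    S ∉ faceComplex (galeDual w) := by
  rintro ⟨⟨h, hw⟩, ⟨hpos : ∀ i, 0 ≤ h i, hS : ∀ i ∈ S, h i = 0⟩, h0⟩
  have hsum : ∑ i, h i * u (w i) = 0 := by
    simpa [map_sum] using congrArg u (mem_dependences.1 hw)
  have hnonneg : ∀ i ∈ Finset.univ, 0 ≤ h i * u (w i) := fun i _ => by
    by_cases hi : i ∈ S
    · rw [hS i hi, zero_mul]
    · exact mul_nonneg (hpos i) (hu i hi).le
  refine h0 (Subtype.ext (funext fun i => ?_))
  by_cases hi : i ∈ S
  · exact hS i hi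
  · have hzero := (Finset.sum_eq_zero_iff_of_nonneg hnonneg).1 hsum i (Finset.mem_univ i)
    exact (mul_eq_zero.1 hzero).resolve_right (hu i hi).ne'

theorem eq_zero_of_galeDual_eq_zero [FiniteDimensional ℝ V]
    (hcard : Fintype.card ι = d + 1 + Module.finrank ℝ V)
    (hw : ∀ T : Finset ι, T.card = Module.finrank ℝ V → LinearIndepOn ℝ w (T : Set ι))
    {h : dependences w} (hS : ∀ i ∈ S, galeDual w i h = 0) (hd : d < S.card) : h = 0 := by
  classical
  have hcompl : Sᶜ.card ≤ Module.finrank ℝ V := by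
    rw [Finset.card_compl]
    omega
  obtain ⟨T, hST, hT⟩ := Finset.exists_superset_card_eq hcompl (by omega)
  obtain ⟨h, hh⟩ := h
  have hzero : ∀ i ∉ T, h i = 0 := fun i hi =>
    hS i (by_contra fun hiS => hi (hST (Finset.mem_compl.2 hiS)))
  have hsum : ∑ i ∈ T, h i • w i = 0 := by
    rw [Finset.sum_subset (Finset.subset_univ T) fun i _ hi => by rw [hzero i hi, zero_smul]]
    exact mem_dependences.1 hh
  refine Subtype.ext (funext fun i => ?_)
  by_cases hi : i ∈ T
  · exact linearIndepOn_finset_iff.1 (hw T hT) h hsum i hi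
  · exact hzero i hi

theorem generalPosition_galeDual [FiniteDimensional ℝ V]
    (hcard : Fintype.card ι = d + 1 + Module.finrank ℝ V)
    (hw : ∀ T : Finset ι, T.card = Module.finrank ℝ V → LinearIndepOn ℝ w (T : Set ι)) :
    GeneralPosition (galeDual w) d := by
  refine ⟨le_antisymm ?_ ?_, by omega, fun h S => eq_zero_of_galeDual_eq_zero hcard hw⟩
  · obtain ⟨S, -, hS⟩ := Finset.exists_subset_card_eq
      (show d + 1 ≤ (Finset.univ : Finset ι).card by rw [Finset.card_univ]; omega)
    have hinj : Function.Injective (LinearMap.pi fun i : S => galeDual w i) := by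
      refine LinearMap.ker_eq_bot.1 (LinearMap.ker_eq_bot'.2 fun h h0 => ?_)
      exact eq_zero_of_galeDual_eq_zero hcard hw (fun i hi => congrFun h0 ⟨i, hi⟩) (by omega)
    simpa [hS] using LinearMap.finrank_le_finrank_of_injective hinj
  · have hrank := LinearMap.finrank_range_add_finrank_ker (Fintype.linearCombination ℝ w)
    have hrange := Submodule.finrank_le (LinearMap.range (Fintype.linearCombination ℝ w))
    rw [Module.finrank_fintype_fun_eq_card] at hrank
    change d + 1 ≤ Module.finrank ℝ (LinearMap.ker _)
    omega

theorem generalPosition_galeDual_of_det_ne_zero {n : ℕ} {w : ι → Fin n → ℝ}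
    (hcard : Fintype.card ι = d + 1 + n)
    (hw : ∀ f : Fin n → ι, Function.Injective f → (Matrix.of fun i => w (f i)).det ≠ 0) :
    GeneralPosition (galeDual w) d := by
  rw [← Module.finrank_fin_fun (n := n) ℝ] at hcard
  refine generalPosition_galeDual hcard fun T hT => ?_
  rw [Module.finrank_fin_fun] at hT
  let e := (T.equivFinOfCardEq hT).symm
  refine (linearIndependent_equiv e).1 ?_
  exact Matrix.linearIndependent_rows_of_det_ne_zero
    (hw (fun i => e i) (Subtype.val_injective.comp e.injective))

end GaleDual

section NineVectors

open Matrix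

/-- Nine integral vectors, any three of them independent, whose Gale dual spans the face fan of a
neighborly `5`-polytope with nine vertices. -/
def nineVectors : Matrix (Fin 9) (Fin 3) ℤ :=
  !![1, -3, -1; 2, -1, 3; -3, 2, 0; 4, 3, -4; 1, 2, 0; -4, -2, -1; 1, -2, 1; -1, 3, 3; -2, 1, -4]

/-- Nonnegative linear dependences of `nineVectors`, one for each facet of the Gale dual; the facet
consists of the indices with vanishing coefficient. -/
def nineDependences : List (Fin 9 → ℕ) :=
  [![11, 9, 15, 4, 0, 0, 0, 0, 0], ![6, 2, 5, 0, 5, 0, 0, 0, 0], ![1, 27, 5, 0, 0, 0, 0, 0, 20],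
    ![13, 11, 0, 0, 45, 20, 0, 0, 0], ![1, 2, 0, 0, 0, 0, 0, 1, 2],
    ![1, 0, 30, 11, 0, 0, 45, 0, 0], ![79, 0, 30, 14, 0, 0, 0, 45, 0],
    ![8, 0, 9, 0, 11, 0, 8, 0, 0], ![12, 0, 5, 0, 7, 0, 0, 4, 0],
    ![83, 0, 0, 28, 0, 30, 0, 75, 0], ![11, 0, 0, 1, 0, 0, 0, 9, 3],
    ![2, 0, 0, 0, 23, 9, 11, 0, 0], ![23, 0, 0, 0, 28, 10, 0, 11, 0],
    ![7, 0, 0, 0, 2, 0, 0, 5, 2], ![0, 73, 30, 41, 0, 55, 0, 0, 0],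
    ![0, 55, 8, 0, 0, 1, 0, 0, 41], ![0, 17, 3, 0, 0, 0, 1, 0, 13],
    ![0, 29, 0, 13, 30, 35, 0, 0, 0], ![0, 83, 0, 61, 0, 95, 0, 30, 0],
    ![0, 19, 0, 0, 8, 5, 0, 0, 13], ![0, 75, 0, 0, 0, 5, 0, 8, 61],
    ![0, 10, 0, 0, 0, 0, 5, 3, 11], ![0, 0, 47, 18, 0, 1, 73, 0, 0],
    ![0, 0, 46, 17, 0, 0, 72, 0, 1], ![0, 0, 11, 0, 17, 0, 32, 0, 8],
    ![0, 0, 0, 2, 47, 21, 29, 0, 0], ![0, 0, 0, 43, 0, 52, 83, 47, 0],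
    ![0, 0, 0, 5, 0, 0, 55, 23, 26], ![0, 0, 0, 0, 29, 11, 19, 0, 2],
    ![0, 0, 0, 0, 10, 0, 35, 11, 17]]

/-- The missing faces of the Gale dual of `nineVectors`, each with a functional that is positive on
the vectors outside it. -/
def nineNonfaces : List (Finset (Fin 9) × (Fin 3 → ℤ)) :=
  [({0, 1, 6}, ![-1, 1, -1]), ({0, 3, 8}, ![-5, 3, 12]), ({0, 5, 6}, ![15, 23, -2]),
    ({0, 5, 8}, ![15, 23, 32]), ({1, 3, 4}, ![-4, -2, 1]), ({1, 6, 7}, ![0, 1, -4]),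
    ({2, 4, 7}, ![3, -5, -3]), ({2, 5, 7}, ![3, -1, -2]), ({2, 5, 8}, ![2, 0, 1]),
    ({3, 4, 8}, ![-1, -1, 1])]

theorem det_nineVectors_submatrix_ne_zero {f : Fin 3 → Fin 9} (hf : Function.Injective f) :
    (nineVectors.submatrix f id).det ≠ 0 := by
  have hdet : ∀ a b c, a ≠ b → a ≠ c → b ≠ c → (nineVectors.submatrix ![a, b, c] id).det ≠ 0 := by
    simp only [det_fin_three]
    decide +kernel
  have hf3 : f = ![f 0, f 1, f 2] := List.ofFn_inj.1 rfl
  rw [hf3]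
  exact hdet _ _ _ (hf.ne (by decide)) (hf.ne (by decide)) (hf.ne (by decide))

theorem nineDependences_spec :
    ∀ h ∈ nineDependences, h ≠ 0 ∧ (fun i => (h i : ℤ)) ᵥ* nineVectors = 0 := by
  decide +kernel

theorem nineNonfaces_spec : ∀ c ∈ nineNonfaces, ∀ i ∉ c.1, 0 < (nineVectors *ᵥ c.2) i := by
  decide +kernel

theorem exists_nineNonface_or_exists_nineDependence {F : Finset (Fin 9)} {m : ℕ}
    (hF : (F, m) ∈ [((∅ : Finset (Fin 9)), 2), ({7, 8}, 1)]) (S : Fin 9 → Bool)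
    (hFS : ∀ i ∈ F, S i) :
    (∃ c ∈ nineNonfaces, (∀ i ∈ c.1, S i) ∧ (c.1 \ F).card = m + 1) ∨
      ∃ h ∈ nineDependences, ∀ i, S i → h i = 0 := by
  have htest : ∀ p ∈ [((∅ : Finset (Fin 9)), 2), ({7, 8}, 1)], ∀ a b c d e f g h i : Bool,
      (∀ j ∈ p.1, ![a, b, c, d, e, f, g, h, i] j) →
        (∃ x ∈ nineNonfaces,
          (∀ j ∈ x.1, ![a, b, c, d, e, f, g, h, i] j) ∧ (x.1 \ p.1).card = p.2 + 1) ∨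
        ∃ y ∈ nineDependences, ∀ j, ![a, b, c, d, e, f, g, h, i] j → y j = 0 := by
    decide +kernel
  have hS : S = ![S 0, S 1, S 2, S 3, S 4, S 5, S 6, S 7, S 8] := List.ofFn_inj.1 rfl
  rw [hS] at hFS ⊢
  exact htest (F, m) hF _ _ _ _ _ _ _ _ _ hFS

/-- The Gale dual of `nineVectors`. -/
noncomputable def nineConfig :
    Fin 9 → Module.Dual ℝ (dependences fun i j => (nineVectors i j : ℝ)) :=
  galeDual fun i j => (nineVectors i j : ℝ)

theorem mem_faceComplex_nineConfig {S : Finset (Fin 9)}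
    (hS : ∃ h ∈ nineDependences, ∀ i ∈ S, h i = 0) : S ∈ faceComplex nineConfig := by
  obtain ⟨h, hh, hS⟩ := hS
  obtain ⟨h0, hw⟩ := nineDependences_spec h hh
  refine mem_faceComplex_galeDual (h := fun i => (h i : ℝ)) (fun e => h0 ?_)
    (fun i => Nat.cast_nonneg _) (funext fun j => ?_) (fun i hi => by rw [hS i hi, Nat.cast_zero])
  · exact funext fun i => Nat.cast_eq_zero.1 (congrFun e i)
  · have := congrArg (Int.cast : ℤ → ℝ) (congrFun hw j)
    simpa [vecMul, dotProduct] using this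

theorem notMem_faceComplex_nineConfig {S : Finset (Fin 9)} (hS : ∃ c ∈ nineNonfaces, c.1 ⊆ S) :
    S ∉ faceComplex nineConfig := by
  obtain ⟨c, hc, hcS⟩ := hS
  refine notMem_faceComplex_galeDual
    (Fintype.linearCombination ℝ fun j => (c.2 j : ℝ)) fun i hi => ?_
  have := Int.cast_pos (R := ℝ).2 (nineNonfaces_spec c hc i (mt (@hcS i) hi))
  simpa [mulVec, dotProduct, Fintype.linearCombination_apply] using this

theorem generalPosition_nineConfig : GeneralPosition nineConfig 5 := by
  refine generalPosition_galeDual_of_det_ne_zero (by simp) fun f hf => ?_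
  have := Int.cast_ne_zero (α := ℝ) |>.2 (det_nineVectors_submatrix_ne_zero hf)
  rwa [Int.cast_det] at this

theorem link_nineConfig {F : Finset (Fin 9)} {m : ℕ}
    (hF : (F, m) ∈ [((∅ : Finset (Fin 9)), 2), ({7, 8}, 1)]) :
    (∀ S, S.card ≤ m → S ∈ link (faceComplex nineConfig) F) ∧
      MissingFacesLE Set.univ (link (faceComplex nineConfig) F) (m + 1) := by
  have htest (S : Finset (Fin 9)) :
      (∃ c ∈ nineNonfaces, c.1 ⊆ F ∪ S ∧ (c.1 \ F).card = m + 1) ∨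
        S ∈ link (faceComplex nineConfig) F := by
    have := exists_nineNonface_or_exists_nineDependence hF (fun i => i ∈ F ∪ S)
      fun i hi => decide_eq_true (Finset.mem_union_left S hi)
    simp only [decide_eq_true_eq] at this
    exact this.imp_right mem_faceComplex_nineConfig
  refine ⟨fun S hS => (htest S).resolve_left ?_, fun S _ hS => ?_⟩
  · rintro ⟨c, -, hcS, hc⟩
    have := Finset.card_le_card (sdiff_le_iff.2 hcS)
    omega
  · obtain ⟨c, hc, hcS, hcard⟩ := (htest S).resolve_right hS
    exact ⟨c.1 \ F, sdiff_le_iff.2 hcS, hcard.le, notMem_faceComplex_nineConfig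
      ⟨c, hc, Finset.subset_union_right.trans_eq Finset.union_sdiff_self_eq_union.symm⟩⟩

theorem missingFacesLE_nineConfig : MissingFacesLE Set.univ (faceComplex nineConfig) 3 := by
  simpa only [link_empty] using (link_nineConfig (F := ∅) (m := 2) (by decide)).2

theorem isSewingFlag_nineConfig : IsSewingFlag (faceComplex nineConfig) [(7, 8), (0, 1)] := by
  have hlower := isLowerSet_faceComplex nineConfig
  have hneighborly := (link_nineConfig (F := ∅) (m := 2) (by decide)).1
  obtain ⟨hneighborly', hmissing'⟩ := link_nineConfig (F := {7, 8}) (m := 1) (by decide)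
  rw [link_empty] at hneighborly
  refine isSewingFlag_cons hlower hneighborly missingFacesLE_nineConfig
    (isSewingFlag_cons (isLowerSet_link hlower _) hneighborly' hmissing' ?_)
  exact mem_faceComplex_nineConfig (by decide +kernel)

end NineVectors

section AlternatingVectors

variable {s t T : ℕ} {S : Finset (Fin (2 * t + 3) × Bool)}
  {x y z : Fin (2 * t + 3) × Bool}

/-- The place of a point in the list of all points, two from each of the `2 * t + 3` groups. -/
def position (x : Fin (2 * t + 3) × Bool) : ℕ :=
  2 * x.1 + x.2.toNat

theorem position_injective : Function.Injective (position (t := t)) := by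
  rintro ⟨g, e⟩ ⟨g', e'⟩ h
  cases e <;> cases e' <;> simp [position, Prod.ext_iff, Fin.ext_iff] at h ⊢ <;> omega

theorem position_lt_two_mul_iff {T : ℕ} : position x < 2 * T ↔ (x.1 : ℕ) < T := by
  have := Bool.toNat_le x.2
  simp only [position]
  omega

theorem position_lt_position (h : x.1 < y.1) : position x < position y :=
  (position_lt_two_mul_iff.2 (Fin.lt_def.1 h)).trans_le (Nat.le_add_right _ _)

/-- Plane vectors whose signs alternate from group to group and whose slopes increase. -/
noncomputable def alternatingVectors (x : Fin (2 * t + 3) × Bool) : Fin 2 → ℝ :=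
  (-1 : ℝ) ^ (x.1 : ℕ) • ![1, (position x : ℝ)]

/-- The Gale dual of `alternatingVectors`. -/
noncomputable def alternatingConfig (t : ℕ) :
    Fin (2 * t + 3) × Bool → Module.Dual ℝ (dependences (alternatingVectors (t := t))) :=
  galeDual (alternatingVectors (t := t))

theorem generalPosition_alternatingConfig :
    GeneralPosition (alternatingConfig t) (2 * (2 * t + 1) + 1) := by
  refine generalPosition_galeDual_of_det_ne_zero (by simp; omega) fun f hf => ?_
  have hpos : (position (f 1) : ℝ) - position (f 0) ≠ 0 :=
    sub_ne_zero.2 fun h => hf.ne Fin.zero_ne_one (position_injective (Nat.cast_injective h)).symm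
  have hdet : (Matrix.of fun i => alternatingVectors (f i)).det =
      (-1) ^ ((f 0).1 : ℕ) * (-1) ^ ((f 1).1 : ℕ) * (position (f 1) - position (f 0)) := by
    simp [Matrix.det_fin_two, alternatingVectors]
    ring
  rw [hdet]
  positivity

theorem neg_one_pow_eq_neg_of_odd_add {R : Type*} [Ring R] {a b : ℕ} (h : Odd (a + b)) :
    (-1 : R) ^ a = -(-1) ^ b := by
  rcases b.even_or_odd with hb | hb
  · rw [(Nat.odd_add.1 h |>.2 hb).neg_one_pow, hb.neg_one_pow]
  · rw [(Nat.odd_add'.1 h |>.1 hb).neg_one_pow, hb.neg_one_pow, neg_neg]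

theorem mem_faceComplex_alternatingConfig (hx : x ∉ S) (hy : y ∉ S) (hz : z ∉ S)
    (hxy : x.1 < y.1) (hyz : y.1 < z.1) (hxy' : Odd ((x.1 : ℕ) + y.1))
    (hyz' : Odd ((y.1 : ℕ) + z.1)) : S ∈ faceComplex (alternatingConfig t) := by
  have hpxy : (position x : ℝ) < position y := Nat.cast_lt.2 (position_lt_position hxy)
  have hpyz : (position y : ℝ) < position z := Nat.cast_lt.2 (position_lt_position hyz)
  have hne : x ≠ y ∧ x ≠ z := ⟨by rintro rfl; exact hxy.false, by rintro rfl; exact hxy.asymm hyz⟩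
  refine mem_faceComplex_galeDual
    (h := Pi.single x (position z - position y : ℝ) + Pi.single y (position z - position x : ℝ) +
      Pi.single z (position y - position x : ℝ)) ?_ ?_ ?_ ?_
  · intro h
    have := congrFun h x
    simp [hne] at this
    linarith
  · refine Pi.le_def.1 (add_nonneg (add_nonneg ?_ ?_) ?_) <;> rw [Pi.single_nonneg] <;> linarith
  · simp only [Pi.add_apply, add_smul, Finset.sum_add_distrib, Pi.single_apply, ite_smul,
      zero_smul, Finset.sum_ite_eq', Finset.mem_univ, if_true, alternatingVectors,
      neg_one_pow_eq_neg_of_odd_add hxy', neg_one_pow_eq_neg_of_odd_add hyz']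
    ext i
    fin_cases i <;> simp <;> ring
  · intro i hi
    simp [ne_of_mem_of_not_mem hi hx, ne_of_mem_of_not_mem hi hy, ne_of_mem_of_not_mem hi hz]

theorem notMem_faceComplex_alternatingConfig (T : ℕ)
    (hT : ∀ x ∉ S, (Odd (x.1 + T : ℕ) ↔ x.1 < T)) : S ∉ faceComplex (alternatingConfig t) := by
  let u : Module.Dual ℝ (Fin 2 → ℝ) :=
    (-1 : ℝ) ^ T • (LinearMap.proj 1 - (2 * T - 1 / 2 : ℝ) • LinearMap.proj 0)
  refine notMem_faceComplex_galeDual u fun x hx => ?_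
  have heval : u (alternatingVectors x) =
      (-1 : ℝ) ^ (x.1 + T : ℕ) * (position x - (2 * T - 1 / 2)) := by
    simp [u, alternatingVectors, pow_add]
    ring
  rw [heval]
  by_cases hxT : x.1 < T
  · have hpos : (position x + 1 : ℝ) ≤ 2 * T := by
      exact_mod_cast position_lt_two_mul_iff.2 hxT
    rw [((hT x hx).2 hxT).neg_one_pow]
    linarith
  · have hpos : (2 * T : ℝ) ≤ position x := by
      exact_mod_cast not_lt.1 (mt position_lt_two_mul_iff.1 hxT)
    rw [(Nat.not_odd_iff_even.1 (mt (hT x hx).1 hxT)).neg_one_pow]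
    linarith

theorem exists_threshold (hS : S ∉ faceComplex (alternatingConfig t)) :
    ∃ T : ℕ, ∀ x ∉ S, (Odd (x.1 + T : ℕ) ↔ x.1 < T) := by
  rcases Sᶜ.eq_empty_or_nonempty with hempty | hnonempty
  · exact ⟨0, fun x hx => absurd (Finset.mem_compl.2 hx) (hempty ▸ Finset.notMem_empty x)⟩
  obtain ⟨x, hx, hxmin⟩ := Finset.exists_min_image Sᶜ Prod.fst hnonempty
  rcases (Sᶜ.filter fun y => Odd (x.1 + y.1 : ℕ)).eq_empty_or_nonempty with hempty | hnonempty
  · refine ⟨x.1, fun y hy => ?_⟩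
    have hxy : x.1 ≤ y.1 := hxmin y (Finset.mem_compl.2 hy)
    have hodd := Finset.filter_eq_empty_iff.1 hempty (Finset.mem_compl.2 hy)
    rw [add_comm] at hodd
    exact iff_of_false hodd (not_lt.2 hxy)
  obtain ⟨y, hy, hymin⟩ := Finset.exists_min_image _ Prod.fst hnonempty
  obtain ⟨hyS, hxy⟩ := Finset.mem_filter.1 hy
  refine ⟨y.1, fun z hz => ⟨fun hodd => ?_, fun hzy => ?_⟩⟩
  · by_contra hyz
    have hxy' : x.1 ≤ y.1 := hxmin y hyS
    refine hS (mem_faceComplex_alternatingConfig (Finset.mem_compl.1 hx) (Finset.mem_compl.1 hyS)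
      hz ?_ ?_ hxy (add_comm (z.1 : ℕ) y.1 ▸ hodd)) <;> grind
  · by_contra hodd
    have := hymin z (Finset.mem_filter.2 ⟨Finset.mem_compl.2 hz, by grind⟩)
    grind

/-- The points of the last `2 * (t - s)` groups. -/
def lateGroups (t s : ℕ) : Finset (Fin (2 * t + 3) × Bool) :=
  Finset.univ.filter fun x => 2 * s + 3 ≤ (x.1 : ℕ)

theorem mem_lateGroups : x ∈ lateGroups t s ↔ 2 * s + 3 ≤ (x.1 : ℕ) := by
  simp [lateGroups]

/-- The groups below `2 * s + 2 + T % 2` on the wrong side of the threshold `T` of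
`exists_threshold`. -/
def thresholdGroups (t s T : ℕ) : Finset (Fin (2 * t + 3)) :=
  Finset.univ.filter fun g => (g : ℕ) < 2 * s + 2 + T % 2 ∧ ¬(Odd (g + T : ℕ) ↔ g < T)

theorem mem_thresholdGroups {g : Fin (2 * t + 3)} : g ∈ thresholdGroups t s T ↔
    (g : ℕ) < 2 * s + 2 + T % 2 ∧ ¬(Odd (g + T : ℕ) ↔ g < T) := by
  simp [thresholdGroups]

theorem card_thresholdGroups (hs : s ≤ t) : (thresholdGroups t s T).card = s + 1 := by
  rw [← Finset.card_range (s + 1)]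
  refine Finset.card_bij (fun g _ => ((g : ℕ) - T % 2) / 2) ?_ ?_ ?_
  · intro g hg
    rw [mem_thresholdGroups, Nat.odd_iff] at hg
    rw [Finset.mem_range]
    omega
  · intro g hg g' hg' h
    rw [mem_thresholdGroups, Nat.odd_iff] at hg hg'
    omega
  · intro i hi
    rw [Finset.mem_range] at hi
    by_cases hiT : 2 * i + T % 2 < T
    · refine ⟨⟨2 * i + T % 2, by omega⟩, ?_, ?_⟩
      · rw [mem_thresholdGroups, Nat.odd_iff]
        dsimp only
        omega
      · dsimp only
        omega
    · refine ⟨⟨2 * i + T % 2 + 1, by omega⟩, ?_, ?_⟩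
      · rw [mem_thresholdGroups, Nat.odd_iff]
        dsimp only
        omega
      · dsimp only
        omega

theorem thresholdGroups_product_notMem_link : thresholdGroups t s T ×ˢ Finset.univ ∉
    link (faceComplex (alternatingConfig t)) (lateGroups t s) := by
  refine notMem_faceComplex_alternatingConfig (min T (2 * s + 2 + T % 2)) fun x hx => ?_
  rw [Finset.mem_union, not_or, mem_lateGroups, Finset.mem_product, mem_thresholdGroups] at hx
  simp only [Finset.mem_univ, and_true, Nat.odd_iff] at hx ⊢
  omega

theorem eq_of_mem_thresholdGroups {g g' : Fin (2 * t + 3)} (hg : g ∈ thresholdGroups t s T)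
    (hg' : g' ∈ thresholdGroups t s T) (hsg : 2 * s + 1 ≤ (g : ℕ)) (hsg' : 2 * s + 1 ≤ (g' : ℕ)) :
    g = g' := by
  rw [mem_thresholdGroups, Nat.odd_iff] at hg hg'
  omega

theorem exists_thresholdGroups_subset
    (hS : S ∉ link (faceComplex (alternatingConfig t)) (lateGroups t s)) :
    ∃ T, thresholdGroups t s T ×ˢ Finset.univ ⊆ S := by
  obtain ⟨T, hT⟩ := exists_threshold hS
  refine ⟨T, fun x hx => ?_⟩
  rw [Finset.mem_product, mem_thresholdGroups] at hx
  have hxS : x ∈ lateGroups t s ∪ S := by_contra fun h => hx.1.2 (hT x h)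
  refine (Finset.mem_union.1 hxS).resolve_left fun h => ?_
  rw [mem_lateGroups] at h
  omega

theorem card_thresholdGroups_product (hs : s ≤ t) :
    (thresholdGroups t s T ×ˢ (Finset.univ : Finset Bool)).card = 2 * s + 2 := by
  rw [Finset.card_product, card_thresholdGroups hs, Finset.card_univ, Fintype.card_bool]
  ring

theorem mem_link_lateGroups_of_card_le (hs : s ≤ t) (hS : S.card ≤ 2 * s + 1) :
    S ∈ link (faceComplex (alternatingConfig t)) (lateGroups t s) := by
  by_contra h
  obtain ⟨T, hT⟩ := exists_thresholdGroups_subset h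
  have := Finset.card_le_card hT
  rw [card_thresholdGroups_product hs] at this
  omega

theorem missingFacesLE_link_lateGroups (hs : s ≤ t) : MissingFacesLE Set.univ
    (link (faceComplex (alternatingConfig t)) (lateGroups t s)) (2 * s + 2) := by
  intro G _ hG
  obtain ⟨T, hT⟩ := exists_thresholdGroups_subset hG
  exact ⟨_, hT, (card_thresholdGroups_product hs).le, thresholdGroups_product_notMem_link⟩

theorem mem_link_pair_lateGroups (hs : s ≤ t) (hx : (x.1 : ℕ) = 2 * s + 2)
    (hy : (y.1 : ℕ) = 2 * s + 1) (hS : S.card ≤ 2 * s) :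
    S ∈ link (link (faceComplex (alternatingConfig t)) (lateGroups t s)) {x, y} := by
  rw [mem_link_pair]
  by_contra h
  obtain ⟨T, hT⟩ := exists_thresholdGroups_subset h
  have hxy : x.1 ∉ thresholdGroups t s T ∨ y.1 ∉ thresholdGroups t s T := by
    by_contra! hmem
    have := eq_of_mem_thresholdGroups hmem.1 hmem.2 (by omega) (by omega)
    omega
  obtain ⟨z, hz⟩ : ∃ z, thresholdGroups t s T ×ˢ Finset.univ ⊆ insert z S := by
    rcases hxy with hx | hy
    · refine ⟨y, (Finset.subset_insert_iff_of_notMem ?_).1 hT⟩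
      simp [hx]
    · rw [Finset.insert_comm] at hT
      refine ⟨x, (Finset.subset_insert_iff_of_notMem ?_).1 hT⟩
      simp [hy]
  have hcard := Finset.card_le_card hz
  have := Finset.card_insert_le z S
  rw [card_thresholdGroups_product hs] at hcard
  omega

theorem missingFacesLE_link_lateGroups_of_fst_eq {B : Finset (Fin (2 * t + 3) × Bool)}
    (hs : s ≤ t) (hx : x ∈ B) (hxy : x ≠ y) (hfst : x.1 = y.1) :
    MissingFacesLE (link (link (faceComplex (alternatingConfig t)) (lateGroups t s)) B)
      (link (link (link (faceComplex (alternatingConfig t)) (lateGroups t s)) B) {y})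
      (2 * s) := by
  refine missingFacesLE_link_link_singleton
    (isLowerSet_link (isLowerSet_faceComplex _) _) hx hxy fun G hG => ?_
  obtain ⟨T, hT⟩ := exists_thresholdGroups_subset hG
  refine ⟨_, hT, (card_thresholdGroups_product hs).le, thresholdGroups_product_notMem_link, ?_⟩
  simp only [Finset.mem_product, hfst, Finset.mem_univ, imp_self]

theorem link_link_lateGroups_succ {K : Set (Finset (Fin (2 * t + 3) × Bool))}
    {g g' : Fin (2 * t + 3)} (hg : (g : ℕ) = 2 * s + 4) (hg' : (g' : ℕ) = 2 * s + 3) :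
    link (link (link K (lateGroups t (s + 1))) {(g, false), (g', false)})
      {(g, true), (g', true)} = link K (lateGroups t s) := by
  have hunion : lateGroups t (s + 1) ∪ ({(g, false), (g', false)} ∪ {(g, true), (g', true)}) =
      lateGroups t s := by
    ext ⟨i, e⟩
    simp only [Finset.mem_union, Finset.mem_insert, Finset.mem_singleton, mem_lateGroups,
      Prod.ext_iff, Fin.ext_iff]
    cases e <;> grind
  ext S
  simp only [mem_link, ← hunion, Finset.union_assoc]

theorem isSewingFlag_link_lateGroups_zero {g g' : Fin (2 * t + 3)} (hg : (g : ℕ) = 2)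
    (hg' : (g' : ℕ) = 1) : IsSewingFlag (link (faceComplex (alternatingConfig t)) (lateGroups t 0))
      [((g, false), (g', false))] :=
  isSewingFlag_cons (isLowerSet_link (isLowerSet_faceComplex _) _)
    (fun _ => mem_link_lateGroups_of_card_le (Nat.zero_le t))
    (missingFacesLE_link_lateGroups (Nat.zero_le t))
    (mem_link_pair_lateGroups (Nat.zero_le t) hg hg' Finset.card_empty.le)

theorem isSewingFlag_link_lateGroups_succ {flag} {g g' : Fin (2 * t + 3)} (hs : s + 1 ≤ t)
    (hg : (g : ℕ) = 2 * s + 4) (hg' : (g' : ℕ) = 2 * s + 3) (hlen : flag.length = 2 * s + 1)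
    (hflag : IsSewingFlag (link (faceComplex (alternatingConfig t)) (lateGroups t s)) flag) :
    IsSewingFlag (link (faceComplex (alternatingConfig t)) (lateGroups t (s + 1)))
      (((g, false), (g', false)) :: ((g, true), (g', true)) :: flag) := by
  have hlower := isLowerSet_faceComplex (alternatingConfig t)
  refine isSewingFlag_cons (isLowerSet_link hlower _)
    (fun _ hS => mem_link_lateGroups_of_card_le hs (by simp only [List.length_cons] at hS; omega))
    (by simp only [List.length_cons, hlen]; exact missingFacesLE_link_lateGroups hs) ?_
  simp only [IsSewingFlag, hlen, link_link_lateGroups_succ hg hg']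
  refine ⟨fun S hS => mem_link_pair_lateGroups hs hg hg' hS,
    missingFacesLE_link_lateGroups_of_fst_eq hs (Finset.mem_insert_self _ _) (by simp) rfl,
    (missingFacesLE_link_lateGroups (by omega)).mono_left (Set.subset_univ _), hflag⟩

theorem exists_isSewingFlag_link_lateGroups (hs : s ≤ t) :
    ∃ flag, flag.length = 2 * s + 1 ∧ (flagVertices flag).Nodup ∧
      (∀ x ∈ flagVertices flag, (x.1 : ℕ) < 2 * s + 3) ∧
      IsSewingFlag (link (faceComplex (alternatingConfig t)) (lateGroups t s)) flag := by
  induction s with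
  | zero =>
    refine ⟨_, rfl, ?_, ?_,
      isSewingFlag_link_lateGroups_zero (g := ⟨2, by omega⟩) (g' := ⟨1, by omega⟩) rfl rfl⟩
    · simp [flagVertices]
    · simp [flagVertices]
  | succ s ih =>
    obtain ⟨flag, hlen, hnodup, hearly, hflag⟩ := ih (by omega)
    refine ⟨_, by simp only [List.length_cons, hlen]; ring, ?_, ?_,
      isSewingFlag_link_lateGroups_succ (g := ⟨2 * s + 4, by omega⟩) (g' := ⟨2 * s + 3, by omega⟩)
        hs rfl rfl hlen hflag⟩
    · have hnew {i} (hi : 2 * s + 3 ≤ i) (hit : i < 2 * t + 3) (e : Bool) :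
          (⟨i, hit⟩, e) ∉ flagVertices flag := fun hmem => (hearly _ hmem).not_ge hi
      simp [flagVertices_cons, hnodup, hnew]
    · simp only [flagVertices_cons, List.forall_mem_cons]
      refine ⟨?_, ?_, ?_, ?_, fun x hx => (hearly x hx).trans ?_⟩ <;> omega

theorem lateGroups_self : lateGroups t t = ∅ := by
  ext x
  simp only [mem_lateGroups, Finset.notMem_empty, iff_false]
  omega

theorem exists_isSewingFlag_alternatingConfig (t : ℕ) :
    ∃ flag, flag.length = 2 * t + 1 ∧ (flagVertices flag).Nodup ∧
      IsSewingFlag (faceComplex (alternatingConfig t)) flag := by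
  obtain ⟨flag, hlen, hnodup, -, hflag⟩ := exists_isSewingFlag_link_lateGroups (le_refl t)
  rw [lateGroups_self, link_empty] at hflag
  exact ⟨flag, hlen, hnodup, hflag⟩

theorem missingFacesLE_alternatingConfig (t : ℕ) :
    MissingFacesLE Set.univ (faceComplex (alternatingConfig t)) (2 * t + 2) := by
  simpa only [lateGroups_self, link_empty] using missingFacesLE_link_lateGroups (le_refl t)

end AlternatingVectors

theorem GeneralPosition.exists_neighborly_polytope_of_card_le {ι : Type} {W E : Type*}
    [DecidableEq ι] [Fintype ι] [NormedAddCommGroup W] [NormedSpace ℝ W] [FiniteDimensional ℝ W]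
    [NormedAddCommGroup E] [NormedSpace ℝ E] [FiniteDimensional ℝ E] {v : ι → Module.Dual ℝ W}
    {flag : List (ι × ι)} {k n : ℕ} (hv : GeneralPosition v (2 * k + 1))
    (hlength : flag.length = k) (hnodup : (flagVertices flag).Nodup)
    (hflag : IsSewingFlag (faceComplex v) flag)
    (hmissing : MissingFacesLE Set.univ (faceComplex v) (k + 1)) (hk : 1 ≤ k)
    (hE : Module.finrank ℝ E = 2 * k + 1) (hn : Fintype.card ι ≤ n) :
    ∃ P : Set E, IsNeighborly P ∧ dim P = 2 * k + 1 ∧ (vertices P).ncard = n ∧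
      (∀ M, IsMissingFace P M → M.card = k + 1) ∧ missingFaceCount P (k + 1) = 0 := by
  subst hlength
  obtain ⟨κ, _, w, hcard, hw, hneighborly, hmissing⟩ :=
    hv.exists_card_eq_add hnodup hflag hmissing (n - Fintype.card ι)
  rw [Nat.add_sub_cancel' hn] at hcard
  exact hcard ▸ hw.exists_neighborly_polytope hk hE hneighborly hmissing

end ConvexPolytope

theorem mainTheorem4_general (k n : ℕ) (h : (Odd k ∧ 2 * k + 4 ≤ n) ∨ (k = 2 ∧ 9 ≤ n)) :
    ∃ P : Set (EuclideanSpace ℝ (Fin (2 * k + 1))),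
      ConvexPolytope.IsNeighborly P ∧
      ConvexPolytope.dim P = 2 * k + 1 ∧
      (ConvexPolytope.vertices P).ncard = n ∧
      (∀ M : Finset (EuclideanSpace ℝ (Fin (2 * k + 1))),
        ConvexPolytope.IsMissingFace P M → M.card = k + 1) ∧
      ConvexPolytope.missingFaceCount P (k + 1) = 0 := by
  rcases h with ⟨⟨t, rfl⟩, hn⟩ | ⟨rfl, hn⟩
  · obtain ⟨flag, hlength, hnodup, hflag⟩ := ConvexPolytope.exists_isSewingFlag_alternatingConfig t
    exact ConvexPolytope.generalPosition_alternatingConfig.exists_neighborly_polytope_of_card_le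
      hlength hnodup hflag (ConvexPolytope.missingFacesLE_alternatingConfig t) (by omega)
      finrank_euclideanSpace_fin (by simp; omega)
  · exact ConvexPolytope.generalPosition_nineConfig.exists_neighborly_polytope_of_card_le rfl
      (by decide) ConvexPolytope.isSewingFlag_nineConfig ConvexPolytope.missingFacesLE_nineConfig
      (by decide) finrank_euclideanSpace_fin hn

theorem mainTheorem4 (k n : ℕ)
    (h : (Odd k ∧ 3 ≤ k ∧ 2 * k + 4 ≤ n) ∨ (k = 2 ∧ 9 ≤ n)) :
    ∃ P : Set (EuclideanSpace ℝ (Fin (2 * k + 1))),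
      ConvexPolytope.IsNeighborly P ∧
      ConvexPolytope.dim P = 2 * k + 1 ∧
      (ConvexPolytope.vertices P).ncard = n ∧
      (∀ M : Finset (EuclideanSpace ℝ (Fin (2 * k + 1))),
        ConvexPolytope.IsMissingFace P M → M.card = k + 1) ∧
      ConvexPolytope.missingFaceCount P (k + 1) = 0 :=
  mainTheorem4_general k n (h.imp_left fun ⟨hk, _, hn⟩ => ⟨hk, hn⟩)
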